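/- Let $m\ge 3$. Let $\mathcal W(m)=(\mathbb R^m)^*\otimes(\mathbb R^m)^*\otimes\mathbb R^m$ be the vector space of constant Christoffel symbols $\Gamma=(\Gamma_{ij}{}^k)$, $1\le i,j,k\le m$, and let $\mathcal Z(m)\subset\mathcal W(m)$ be the subspace of torsion free symbols, i.e. $\Gamma_{ij}{}^k=\Gamma_{ji}{}^k$. For $\Gamma\in\mathcal W(m)$ let (summing over repeated indices) $$\rho_{\Gamma,jk}=\Gamma_{in}{}^i\Gamma_{jk}{}^n-\Gamma_{jn}{}^i\Gamma_{ik}{}^n,\qquad \rho_{s,\Gamma,jk}=\tfrac12(\rho_{\Gamma,jk}+\rho_{\Gamma,kj})$$ be the Ricci tensor and the symmetric Ricci tensor. For $p+q=m$ let $\mathcal W(p,q)$ (resp. $\mathcal Z(p,q)$) be the set of $\Gamma\in\mathcal W(m)$ (resp. $\Gamma\in\mathcal Z(m)$) such that $\rho_{s,\Gamma}$ has signature $(p,q)$, with $p$ negative and $q$ positive directions. The group $\mathrm{GL}^+(m,\mathbb R)$ of matrices with positive determinant acts on $\mathcal W(m)$ and on $\mathcal Z(m)$ by linear change of coordinates,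 $(T\Gamma)(x,y)=T\,\Gamma(T^{-1}x,T^{-1}y)$. There is a polynomial $\mathfrak P_m$ on $\mathcal W(m)$, divisible by the polynomial $\Gamma\mapsto\det\rho_{s,\Gamma}$ and not vanishing identically on $\mathcal Z(m)$, such that for all $p,q\ge0$ with $p+q=m$ the following holds for each of the sets $$\mathcal W(p,q;\mathfrak P_m)=\{\Gamma\in\mathcal W(p,q):\mathfrak P_m(\Gamma)\ne0\},\qquad \mathcal Z(p,q;\mathfrak P_m)=\{\Gamma\in\mathcal Z(p,q):\mathfrak P_m(\Gamma)\ne0\}.$$ The set is open in $\mathcal W(m)$ (resp. in $\mathcal Z(m)$) and $\mathrm{GL}^+(m,\mathbb R)$-invariant, and $\mathrm{GL}^+(m,\mathbb R)$ acts on it properly and without fixed points (all isotropy groups are trivial). Consequently the moduli spaces $$\mathfrak W^+(p,q;\mathfrak P_m)=\mathcal W(p,q;\mathfrak P_m)/\mathrm{GL}^+(m,\mathbb R),\qquad \mathfrak Z^+(p,q;\mathfrak P_m)=\mathcal Z(p,q;\mathfrak P_m)/\mathrm{GL}^+(m,\mathbb R),$$ with their quotient topologies, are Hausdorff and second countable and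 carry structures of smooth manifolds such that the projections $$\mathcal W(p,q;\mathfrak P_m)\to\mathfrak W^+(p,q;\mathfrak P_m),\qquad \mathcal Z(p,q;\mathfrak P_m)\to\mathfrak Z^+(p,q;\mathfrak P_m)$$ are smooth principal $\mathrm{GL}^+(m,\mathbb R)$-bundles. -/

import Mathlib

open scoped Manifold ContDiff MatrixGroups

noncomputable section

namespace TypeA

/-! ### Christoffel symbols and the Ricci tensor -/

/-- The Ricci tensor `ρ_{jk} = Γ_{in}^i Γ_{jk}^n - Γ_{jn}^i Γ_{ik}^n` of constant Christoffel symbols,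
where `Γ i j k` stands for `Γ_{ij}^k`. The symbols may lie in any commutative ring, so that the
formula also makes sense for the generic symbols (the coordinate polynomials). -/
def ricci {m : ℕ} {A : Type*} [CommRing A] (Γ : Fin m → Fin m → Fin m → A) :
    Matrix (Fin m) (Fin m) A :=
  Matrix.of fun j k =>
    (∑ i, ∑ n, Γ i n i * Γ j k n) - ∑ i, ∑ n, Γ j n i * Γ i k n

/-- The symmetric Ricci tensor `ρ_s = (ρ_{jk} + ρ_{kj}) / 2`. -/
def symRicci {m : ℕ} {A : Type*} [CommRing A] [Algebra ℝ A] (Γ : Fin m → Fin m → Fin m → A) :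
    Matrix (Fin m) (Fin m) A :=
  (1 / 2 : ℝ) • (ricci Γ + (ricci Γ).transpose)

/-- The space `𝒲(m)` of all constant Christoffel symbols on `ℝ^m`; `Γ i j k` is `Γ_{ij}^k`. -/
abbrev W (m : ℕ) : Type := Fin m → Fin m → Fin m → ℝ

/-- The space `𝒵(m)` of torsion free Christoffel symbols: `Γ_{ij}^k = Γ_{ji}^k`. -/
def Z (m : ℕ) : Submodule ℝ (W m) where
  carrier := {Γ | ∀ i j k, Γ i j k = Γ j i k}
  add_mem' := fun ha hb i j k => congrArg₂ (· + ·) (ha i j k) (hb i j k)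
  zero_mem' := fun _ _ _ => rfl
  smul_mem' := fun c _ ha i j k => congrArg (c * ·) (ha i j k)

/-- Polynomials on `𝒲(m)`, in the coordinates `Γ_{ij}^k`. -/
abbrev WPoly (m : ℕ) : Type := MvPolynomial (Fin m × Fin m × Fin m) ℝ

/-- The value `P(Γ)` of a polynomial on `𝒲(m)`. -/
def WPoly.evalAt {m : ℕ} (P : WPoly m) (Γ : W m) : ℝ :=
  MvPolynomial.eval (fun x => Γ x.1 x.2.1 x.2.2) P

/-- The polynomial `det ρ_s` on `𝒲(m)`. -/
def detSymRicciPoly (m : ℕ) : WPoly m :=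
  (symRicci fun i j k => (MvPolynomial.X (i, j, k) : WPoly m)).det

/-- `sign(ρ_{s,Γ}) = (p, q)`: there are `p` timelike (negative) and `q` spacelike (positive)
directions. -/
def HasRicciSignature {m : ℕ} (p q : ℕ) (Γ : W m) : Prop :=
  sigNeg (symRicci Γ).toQuadraticForm' = p ∧ sigPos (symRicci Γ).toQuadraticForm' = q

/-- `𝒲(p, q; P)`, for `p + q = m`. -/
def WGen {m : ℕ} (p q : ℕ) (P : WPoly m) : Set (W m) :=
  {Γ | HasRicciSignature p q Γ ∧ P.evalAt Γ ≠ 0}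

/-- `𝒵(p, q; P)`, for `p + q = m`, as a subset of the vector space `𝒵(m)`. -/
def ZGen {m : ℕ} (p q : ℕ) (P : WPoly m) : Set (Z m) :=
  {Γ | HasRicciSignature p q (Γ : W m) ∧ P.evalAt (Γ : W m) ≠ 0}

/-! ### The action of `GL⁺(m, ℝ)` -/

/-- The matrix underlying an element of `GL⁺(m, ℝ)`. -/
def mat {m : ℕ} (T : GL(m, ℝ)⁺) : Matrix (Fin m) (Fin m) ℝ := ((T : GL (Fin m) ℝ) : Matrix _ _ ℝ)

/-- Linear change of coordinates: two indices are down and one is up, that is,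
`(T • Γ)(x, y) = T (Γ (T⁻¹ x, T⁻¹ y))`. -/
instance (m : ℕ) : SMul (GL(m, ℝ)⁺) (W m) where
  smul T Γ := fun i j k =>
    ∑ a, ∑ b, ∑ c, mat T⁻¹ a i * mat T⁻¹ b j * mat T k c * Γ a b c

theorem smul_apply {m : ℕ} (T : GL(m, ℝ)⁺) (Γ : W m) (i j k : Fin m) :
    (T • Γ) i j k = ∑ a, ∑ b, ∑ c, mat T⁻¹ a i * mat T⁻¹ b j * mat T k c * Γ a b c := rfl

theorem mat_one {m : ℕ} : mat (1 : GL(m, ℝ)⁺) = 1 := rfl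

theorem mat_mul {m : ℕ} (S T : GL(m, ℝ)⁺) : mat (S * T) = mat S * mat T := rfl

theorem sum_comm_three {m : ℕ} (f : Fin m → Fin m → Fin m → Fin m → Fin m → Fin m → ℝ) :
    ∑ a, ∑ b, ∑ c, ∑ a', ∑ b', ∑ c', f a b c a' b' c' =
      ∑ a', ∑ b', ∑ c', ∑ a, ∑ b, ∑ c, f a b c a' b' c' := by
  have h := Finset.sum_comm (s := (Finset.univ : Finset (Fin m × Fin m × Fin m)))
    (t := (Finset.univ : Finset (Fin m × Fin m × Fin m)))
    (f := fun x y => f x.1 x.2.1 x.2.2 y.1 y.2.1 y.2.2)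
  simpa only [Fintype.sum_prod_type] using h

instance (m : ℕ) : MulAction (GL(m, ℝ)⁺) (W m) where
  one_smul Γ := by
    funext i j k
    simp [smul_apply, mat_one, Matrix.one_apply]
  mul_smul S T Γ := by
    funext i j k
    simp only [smul_apply, mul_inv_rev, mat_mul, Matrix.mul_apply, Finset.mul_sum]
    rw [sum_comm_three]
    refine Finset.sum_congr rfl fun a _ => Finset.sum_congr rfl fun b _ =>
      Finset.sum_congr rfl fun c _ => ?_
    simp only [Finset.sum_mul]
    rw [Finset.sum_congr rfl fun c' _ => Finset.sum_comm, Finset.sum_comm]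
    refine Finset.sum_congr rfl fun a' _ => ?_
    rw [Finset.sum_comm]
    refine Finset.sum_congr rfl fun b' _ => Finset.sum_congr rfl fun c' _ => ?_
    ring

theorem smul_mem_Z {m : ℕ} (T : GL(m, ℝ)⁺) {Γ : W m} (hΓ : Γ ∈ Z m) : T • Γ ∈ Z m := by
  intro i j k
  rw [smul_apply, smul_apply, Finset.sum_comm]
  refine Finset.sum_congr rfl fun a _ => Finset.sum_congr rfl fun b _ =>
    Finset.sum_congr rfl fun c _ => ?_
  rw [hΓ b a c]
  ring

instance (m : ℕ) : MulAction (GL(m, ℝ)⁺) (Z m) where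
  smul T Γ := ⟨T • (Γ : W m), smul_mem_Z T Γ.2⟩
  one_smul Γ := Subtype.ext (one_smul _ (Γ : W m))
  mul_smul S T Γ := Subtype.ext (mul_smul S T (Γ : W m))

/-- The inclusion of `GL⁺(m, ℝ)` into the space of matrices (written as functions, which carry a
norm) is an open embedding; it is the chart of the Lie group `GL⁺(m, ℝ)`. -/
theorem isOpenEmbedding_mat (m : ℕ) :
    Topology.IsOpenEmbedding (fun T : GL(m, ℝ)⁺ => (mat T : Fin m → Fin m → ℝ)) := by
  let _ : NormedRing (Matrix (Fin m) (Fin m) ℝ) := Matrix.linftyOpNormedRing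
  let _ : NormedSpace ℝ (Matrix (Fin m) (Fin m) ℝ) := Matrix.linftyOpNormedSpace
  have : CompleteSpace (Matrix (Fin m) (Fin m) ℝ) := FiniteDimensional.complete ℝ _
  have h1 : Topology.IsOpenEmbedding (Units.val : (Matrix (Fin m) (Fin m) ℝ)ˣ → _) :=
    Units.isOpenEmbedding_val
  have h2 : IsOpen ((Matrix.GLPos (Fin m) ℝ : Subgroup (GL (Fin m) ℝ)) : Set (GL (Fin m) ℝ)) :=
    isOpen_lt continuous_const (Continuous.matrix_det Units.continuous_val)
  exact h1.comp h2.isOpenEmbedding_subtypeVal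

instance (m : ℕ) : ChartedSpace (Fin m → Fin m → ℝ) (GL(m, ℝ)⁺) :=
  (isOpenEmbedding_mat m).singletonChartedSpace

/-! ### Invariant open subsets and smooth principal bundles -/

/-- The restriction of a group action to an invariant open subset. -/
abbrev restrictAction {G X : Type*} [Group G] [MulAction G X] [TopologicalSpace X]
    (U : TopologicalSpace.Opens X) (hU : ∀ (g : G), ∀ x ∈ U, g • x ∈ U) : MulAction G U where
  smul g x := ⟨g • (x : X), hU g x x.2⟩
  one_smul x := Subtype.ext (one_smul G (x : X))
  mul_smul g h x := Subtype.ext (mul_smul g h (x : X))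

section Bundle

variable {EG HG EN HN EB HB : Type*}
  [NormedAddCommGroup EG] [NormedSpace ℝ EG] [TopologicalSpace HG]
  [NormedAddCommGroup EN] [NormedSpace ℝ EN] [TopologicalSpace HN]
  [NormedAddCommGroup EB] [NormedSpace ℝ EB] [TopologicalSpace HB]

/-- `π : N → B` is a smooth principal `G`-bundle: `G` acts smoothly on `N`, `π` is smooth, and around
every point of `B` there is a smooth trivialization `π⁻¹(V) ≃ V × G` over `V` with smooth inverse
that turns the action of `G` on `N` into the translation of the factor `G`. -/
structure IsSmoothPrincipalBundle (IG : ModelWithCorners ℝ EG HG) (IN : ModelWithCorners ℝ EN HN)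
    (IB : ModelWithCorners ℝ EB HB)
    (G : Type*) [Group G] [TopologicalSpace G] [ChartedSpace HG G]
    {N : Type*} [TopologicalSpace N] [ChartedSpace HN N] [MulAction G N]
    {B : Type*} [TopologicalSpace B] [ChartedSpace HB B] (π : N → B) : Prop where
  contMDiff_smul : ContMDiff (IG.prod IN) IN ∞ fun x : G × N => x.1 • x.2
  contMDiff_proj : ContMDiff IN IB ∞ π
  locally_trivial : ∀ b : B, ∃ e : Bundle.Trivialization G π,
    b ∈ e.baseSet ∧
    ContMDiffOn IN (IB.prod IG) ∞ e e.source ∧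
    ContMDiffOn (IB.prod IG) IN ∞ e.toOpenPartialHomeomorph.symm e.target ∧
    ∀ (g : G), ∀ x ∈ e.source, g • x ∈ e.source ∧ e (g • x) = ((e x).1, g * (e x).2)

/-- The orbit space `N / G`, with the quotient topology, carries a structure of a smooth manifold
(Hausdorff, second countable, of some dimension `d`) for which the projection `N → N / G` is a
smooth principal `G`-bundle. -/
def HasSmoothPrincipalQuotient (IG : ModelWithCorners ℝ EG HG) (IN : ModelWithCorners ℝ EN HN)
    (G : Type*) [Group G] [TopologicalSpace G] [ChartedSpace HG G]
    (N : Type*) [TopologicalSpace N] [ChartedSpace HN N] [MulAction G N] : Prop :=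
  T2Space (MulAction.orbitRel.Quotient G N) ∧
  SecondCountableTopology (MulAction.orbitRel.Quotient G N) ∧
  ∃ (d : ℕ) (_ : ChartedSpace (EuclideanSpace ℝ (Fin d)) (MulAction.orbitRel.Quotient G N)),
    IsManifold (𝓡 d) ∞ (MulAction.orbitRel.Quotient G N) ∧
    IsSmoothPrincipalBundle IG IN (𝓡 d) G
      (Quotient.mk _ : N → MulAction.orbitRel.Quotient G N)

end Bundle

/-- For a subset `S` of a vector space `X` on which `GL⁺(m, ℝ)` acts: `S` is open and invariant,
`GL⁺(m, ℝ)` acts on it properly and without fixed points, and `S → S / GL⁺(m, ℝ)` is a smooth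
principal bundle over a smooth manifold. -/
def IsPrincipalDomain (m : ℕ) {X : Type*} [NormedAddCommGroup X] [NormedSpace ℝ X]
    [MulAction (GL(m, ℝ)⁺) X] (S : Set X) : Prop :=
  ∃ (hopen : IsOpen S) (hinv : ∀ (T : GL(m, ℝ)⁺), ∀ Γ ∈ S, T • Γ ∈ S),
    letI U : TopologicalSpace.Opens X := ⟨S, hopen⟩
    letI : MulAction (GL(m, ℝ)⁺) U := restrictAction U hinv
    ProperSMul (GL(m, ℝ)⁺) U ∧
    (∀ Γ : U, MulAction.stabilizer (GL(m, ℝ)⁺) Γ = ⊥) ∧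
    HasSmoothPrincipalQuotient 𝓘(ℝ, Fin m → Fin m → ℝ) 𝓘(ℝ, X) (GL(m, ℝ)⁺) U

end TypeA

end

/-!
For symbols `Γ`, let `ω(y)` be the trace of `x ↦ Γ(x, y)`. Where the bilinear form `ω(Γ(·, ·))` is
nondegenerate there is a unique vector `v` with `ω(Γ(v, ·)) = ω`, and where, moreover, the iterates
`v, Γ(v, v), Γ(v, Γ(v, v)), …` span, the first `m` of them form a frame which depends smoothly and
equivariantly on `Γ`. Both conditions are polynomial, and each orbit of `GL⁺(m, ℝ)` contains exactly
one `Γ` whose frame is the standard basis or a fixed basis of the opposite orientation. The symbols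
whose frame is the standard basis are an open part of an affine space, so that the domain is
globally a product of `GL⁺(m, ℝ)` and two copies of an open subset of a Euclidean space.
-/

open scoped Manifold ContDiff MatrixGroups

noncomputable section

namespace TypeA

open Matrix

/-! ### Smooth structures along a homeomorphism -/

section ChartedSpaceComap

variable {H Y B : Type*} [TopologicalSpace H] [TopologicalSpace Y] [TopologicalSpace B]
  [ChartedSpace H B]

/-- The charted space structure on `Y` for which a given homeomorphism `Y ≃ₜ B` is a
diffeomorphism. -/
abbrev chartedSpaceComap (F : Y ≃ₜ B) : ChartedSpace H Y where
  atlas := F.transOpenPartialHomeomorph '' atlas H B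
  chartAt y := F.transOpenPartialHomeomorph (chartAt H (F y))
  mem_chart_source y := mem_chart_source H (F y)
  chart_mem_atlas y := Set.mem_image_of_mem _ (chart_mem_atlas H (F y))

variable {E : Type*} [NormedAddCommGroup E] [NormedSpace ℝ E] (I : ModelWithCorners ℝ E H)
  (r : ℕ∞ω) [IsManifold I r B] (F : Y ≃ₜ B)

theorem isManifold_comap :
    letI := chartedSpaceComap (H := H) F
    IsManifold I r Y := by
  let _ := chartedSpaceComap (H := H) F
  refine IsManifold.mk' (gr := ⟨?_⟩)
  rintro _ _ ⟨e, he, rfl⟩ ⟨e', he', rfl⟩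
  have transition : (F.transOpenPartialHomeomorph e).symm ≫ₕ F.transOpenPartialHomeomorph e' =
      e.symm ≫ₕ e' := by
    ext x <;> simp
  rw [transition]
  exact HasGroupoid.compatible he he'

theorem contMDiff_comap :
    letI := chartedSpaceComap (H := H) F
    ContMDiff I I r F := by
  let _ := chartedSpaceComap (H := H) F
  have := isManifold_comap I r F
  intro y
  have hy := (chartAt H y).open_source.mem_nhds (mem_chart_source H y)
  refine (((contMDiffOn_chart_symm (I := I) (n := r) (x := F y)).comp contMDiffOn_chart
    fun z hz => (chartAt H y).map_source hz).contMDiffAt hy).congr_of_eventuallyEq ?_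
  filter_upwards [hy] with z hz
  exact ((chartAt H (F y)).left_inv hz).symm

theorem contMDiff_comap_symm :
    letI := chartedSpaceComap (H := H) F
    ContMDiff I I r F.symm := by
  let _ := chartedSpaceComap (H := H) F
  have := isManifold_comap I r F
  intro b
  have hb := (chartAt H b).open_source.mem_nhds (mem_chart_source H b)
  have he : F.transOpenPartialHomeomorph (chartAt H b) ∈ IsManifold.maximalAtlas I r Y :=
    IsManifold.subset_maximalAtlas (Set.mem_image_of_mem _ (chart_mem_atlas H b))
  refine (((contMDiffOn_symm_of_mem_maximalAtlas he).comp contMDiffOn_chart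
    fun z hz => (chartAt H b).map_source hz).contMDiffAt hb).congr_of_eventuallyEq ?_
  filter_upwards [hb] with z hz
  simp [(chartAt H b).left_inv hz]

end ChartedSpaceComap

/-! ### Actions with a global slice -/

section GlobalSlice

variable {EG HG EN HN EB HB : Type*}
  [NormedAddCommGroup EG] [NormedSpace ℝ EG] [TopologicalSpace HG]
  [NormedAddCommGroup EN] [NormedSpace ℝ EN] [TopologicalSpace HN]
  [NormedAddCommGroup EB] [NormedSpace ℝ EB] [TopologicalSpace HB]
  {G N B : Type*} [Group G] [TopologicalSpace G] [ChartedSpace HG G]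
  [TopologicalSpace N] [ChartedSpace HN N] [MulAction G N]
  [TopologicalSpace B] [ChartedSpace HB B]

/-- A global slice of a smooth action of `G` on `N`: a section `s : B → N` for which
`(b, g) ↦ g • s b` is a diffeomorphism `B × G ≃ N`. Its inverse is recorded as `x ↦ (q x, φ x)`. -/
structure IsGlobalSlice (IG : ModelWithCorners ℝ EG HG) (IN : ModelWithCorners ℝ EN HN)
    (IB : ModelWithCorners ℝ EB HB) (s : B → N) (q : N → B) (φ : N → G) : Prop where
  contMDiff_smul : ContMDiff (IG.prod IN) IN ∞ fun x : G × N => x.1 • x.2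
  contMDiff_section : ContMDiff IB IN ∞ s
  contMDiff_proj : ContMDiff IN IB ∞ q
  contMDiff_frame : ContMDiff IN IG ∞ φ
  smul_section : ∀ x, φ x • s (q x) = x
  proj_smul_section : ∀ (g : G) (b : B), q (g • s b) = b
  frame_smul_section : ∀ (g : G) (b : B), φ (g • s b) = g

namespace IsGlobalSlice

variable {IG : ModelWithCorners ℝ EG HG} {IN : ModelWithCorners ℝ EN HN}
  {IB : ModelWithCorners ℝ EB HB} {s : B → N} {q : N → B} {φ : N → G}

theorem proj_smul (h : IsGlobalSlice IG IN IB s q φ) (g : G) (x : N) : q (g • x) = q x := by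
  conv_lhs => rw [← h.smul_section x, smul_smul, h.proj_smul_section]

theorem frame_smul (h : IsGlobalSlice IG IN IB s q φ) (g : G) (x : N) : φ (g • x) = g * φ x := by
  conv_lhs => rw [← h.smul_section x, smul_smul, h.frame_smul_section]

theorem proj_section (h : IsGlobalSlice IG IN IB s q φ) (b : B) : q (s b) = b := by
  simpa only [one_smul] using h.proj_smul_section 1 b

theorem stabilizer_eq_bot (h : IsGlobalSlice IG IN IB s q φ) (x : N) :
    MulAction.stabilizer G x = ⊥ := by
  refine (Subgroup.eq_bot_iff_forall _).2 fun g hg => ?_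
  have hφ := h.frame_smul g x
  rw [MulAction.mem_stabilizer_iff.1 hg] at hφ
  exact right_eq_mul.1 hφ

theorem range_smul_prod (h : IsGlobalSlice IG IN IB s q φ) :
    Set.range (fun z : G × N => (z.1 • z.2, z.2)) = {z | q z.1 = q z.2} := by
  ext ⟨x, y⟩
  constructor
  · rintro ⟨⟨g, z⟩, hz⟩
    obtain ⟨rfl, rfl⟩ := Prod.ext_iff.1 hz
    exact h.proj_smul g z
  · intro hxy
    have hy : (φ y)⁻¹ • y = s (q y) := inv_smul_eq_iff.2 (h.smul_section y).symm
    have hx : (φ x * (φ y)⁻¹) • y = x := by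
      rw [mul_smul, hy, ← show q x = q y from hxy, h.smul_section]
    exact ⟨(φ x * (φ y)⁻¹, y), Prod.ext hx rfl⟩

theorem properSMul [IsTopologicalGroup G] [T2Space B] (h : IsGlobalSlice IG IN IB s q φ) :
    ProperSMul G N := by
  have hφ := h.contMDiff_frame.continuous
  have hq := h.contMDiff_proj.continuous
  have hleft : Function.LeftInverse (fun z : N × N => (φ z.1 * (φ z.2)⁻¹, z.2))
      (fun z : G × N => (z.1 • z.2, z.2)) := fun ⟨g, x⟩ => by
    simp [h.frame_smul]
  have hleft_cont : Continuous fun z : N × N => (φ z.1 * (φ z.2)⁻¹, z.2) := by fun_prop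
  refine ⟨Topology.IsClosedEmbedding.isProperMap
    ⟨hleft.isEmbedding hleft_cont (h.contMDiff_smul.continuous.prodMk continuous_snd), ?_⟩⟩
  rw [h.range_smul_prod]
  exact isClosed_eq (hq.comp continuous_fst) (hq.comp continuous_snd)

theorem mk_smul_section (h : IsGlobalSlice IG IN IB s q φ) (g : G) (x : N) :
    (Quotient.mk _ (g • s (q x)) : MulAction.orbitRel.Quotient G N) = Quotient.mk _ x := by
  refine Quotient.sound (MulAction.orbitRel_apply.2 ⟨g * (φ x)⁻¹, ?_⟩)
  exact (mul_smul _ _ _).trans (congrArg (g • ·) (inv_smul_eq_iff.2 (h.smul_section x).symm))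

/-- The orbit space of an action with a global slice is the base of the slice. -/
def orbitHomeomorph (h : IsGlobalSlice IG IN IB s q φ) : MulAction.orbitRel.Quotient G N ≃ₜ B where
  toFun := Quotient.lift q fun _ x ⟨g, hg⟩ => hg ▸ h.proj_smul g x
  invFun b := Quotient.mk _ (s b)
  left_inv := Quotient.ind fun x =>
    (congrArg _ (one_smul G (s (q x))).symm).trans (h.mk_smul_section 1 x)
  right_inv := h.proj_section
  continuous_toFun := h.contMDiff_proj.continuous.quotient_lift _
  continuous_invFun := continuous_quotient_mk'.comp h.contMDiff_section.continuous

/-- The global trivialization of `N → N / G` defined by a global slice. -/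
def trivialization (h : IsGlobalSlice IG IN IB s q φ) :
    Bundle.Trivialization G (Quotient.mk _ : N → MulAction.orbitRel.Quotient G N) where
  toFun x := (Quotient.mk _ x, φ x)
  invFun z := z.2 • s (h.orbitHomeomorph z.1)
  source := Set.univ
  target := Set.univ
  map_source' _ _ := Set.mem_univ _
  map_target' _ _ := Set.mem_univ _
  left_inv' x _ := h.smul_section x
  right_inv' := fun ⟨b, g⟩ _ => by
    induction b using Quotient.ind with
    | _ x => exact Prod.ext (h.mk_smul_section g x) (h.frame_smul_section g (q x))
  open_source := isOpen_univ
  open_target := isOpen_univ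
  continuousOn_toFun :=
    (continuous_quotient_mk'.prodMk h.contMDiff_frame.continuous).continuousOn
  continuousOn_invFun := (h.contMDiff_smul.continuous.comp (continuous_snd.prodMk
    (h.contMDiff_section.continuous.comp
      (h.orbitHomeomorph.continuous.comp continuous_fst)))).continuousOn
  baseSet := Set.univ
  open_baseSet := isOpen_univ
  source_eq := rfl
  target_eq := Set.univ_prod_univ.symm
  proj_toFun _ _ := rfl

theorem hasSmoothPrincipalQuotient {d : ℕ} [ChartedSpace (EuclideanSpace ℝ (Fin d)) B]
    [IsManifold (𝓡 d) ∞ B] [T2Space B] [SecondCountableTopology B]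
    (h : IsGlobalSlice IG IN (𝓡 d) s q φ) : HasSmoothPrincipalQuotient IG IN G N := by
  let F := h.orbitHomeomorph
  let _ := chartedSpaceComap (H := EuclideanSpace ℝ (Fin d)) F
  have proj_smooth : ContMDiff IN (𝓡 d) ∞
      (Quotient.mk _ : N → MulAction.orbitRel.Quotient G N) :=
    ((contMDiff_comap_symm (𝓡 d) ∞ F).comp h.contMDiff_proj).congr fun x =>
      (F.symm_apply_apply _).symm
  have inv_smooth : ContMDiff ((𝓡 d).prod IG) IN ∞
      fun z : MulAction.orbitRel.Quotient G N × G => z.2 • s (F z.1) :=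
    h.contMDiff_smul.comp (contMDiff_snd.prodMk
      (h.contMDiff_section.comp ((contMDiff_comap (𝓡 d) ∞ F).comp contMDiff_fst)))
  refine ⟨F.symm.t2Space, F.isEmbedding.secondCountableTopology, d, inferInstance,
    isManifold_comap (𝓡 d) ∞ F, h.contMDiff_smul, proj_smooth, fun b => ⟨h.trivialization,
      Set.mem_univ _, (proj_smooth.prodMk h.contMDiff_frame).contMDiffOn, inv_smooth.contMDiffOn,
      fun g x _ => ⟨Set.mem_univ _, Prod.ext ?_ (h.frame_smul g x)⟩⟩⟩
  exact Quotient.sound (MulAction.orbitRel_apply.2 ⟨g, rfl⟩)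

end IsGlobalSlice

end GlobalSlice

/-! ### Equivariant frames -/

section MatrixCalculus

variable {𝕜 E ι : Type*} [NontriviallyNormedField 𝕜] [NormedAddCommGroup E] [NormedSpace 𝕜 E]
  [Fintype ι] [DecidableEq ι] {s : Set E} {r : ℕ∞ω} {B C : E → Matrix ι ι 𝕜}

theorem contDiffOn_matrix_det (hB : ∀ i j, ContDiffOn 𝕜 r (fun x => B x i j) s) :
    ContDiffOn 𝕜 r (fun x => (B x).det) s := by
  simp only [det_apply]
  exact ContDiffOn.sum fun σ _ => (contDiffOn_prod fun i _ => hB _ _).const_smul _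

theorem contDiffOn_matrix_adjugate (hB : ∀ i j, ContDiffOn 𝕜 r (fun x => B x i j) s) (i j : ι) :
    ContDiffOn 𝕜 r (fun x => (B x).adjugate i j) s := by
  simp only [adjugate_apply]
  refine contDiffOn_matrix_det fun k l => ?_
  simp only [updateRow_apply]
  split_ifs
  · exact contDiffOn_const
  · exact hB k l

theorem contDiffOn_matrix_inv (hB : ∀ i j, ContDiffOn 𝕜 r (fun x => B x i j) s)
    (h : ∀ x ∈ s, (B x).det ≠ 0) (i j : ι) : ContDiffOn 𝕜 r (fun x => (B x)⁻¹ i j) s := by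
  simp only [inv_def, Ring.inverse_eq_inv', Matrix.smul_apply, smul_eq_mul]
  exact ((contDiffOn_matrix_det hB).inv h).mul (contDiffOn_matrix_adjugate hB i j)

end MatrixCalculus

section GLPos

variable {m : ℕ}

theorem mat_inv_mul_mat (T : GL(m, ℝ)⁺) : mat T⁻¹ * mat T = 1 := by
  rw [← mat_mul, inv_mul_cancel, mat_one]

theorem mat_inv (T : GL(m, ℝ)⁺) : mat T⁻¹ = (mat T)⁻¹ :=
  (inv_eq_left_inv (mat_inv_mul_mat T)).symm

theorem mat_injective : Function.Injective (mat : GL(m, ℝ)⁺ → Matrix (Fin m) (Fin m) ℝ) :=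
  (isOpenEmbedding_mat m).injective

theorem det_mat_pos (T : GL(m, ℝ)⁺) : 0 < (mat T).det := T.2

/-- The element of `GL⁺(m, ℝ)` given by a matrix of positive determinant. -/
def toGLPos (B : Matrix (Fin m) (Fin m) ℝ) (h : 0 < B.det) : GL(m, ℝ)⁺ :=
  ⟨GeneralLinearGroup.mkOfDetNeZero B h.ne', h⟩

theorem mat_toGLPos (B : Matrix (Fin m) (Fin m) ℝ) (h : 0 < B.det) : mat (toGLPos B h) = B := rfl

theorem contMDiff_mat (m : ℕ) :
    ContMDiff 𝓘(ℝ, Fin m → Fin m → ℝ) 𝓘(ℝ, Fin m → Fin m → ℝ) ∞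
      (fun (T : GL(m, ℝ)⁺) i j => mat T i j) :=
  contMDiff_isOpenEmbedding (isOpenEmbedding_mat m)

theorem contMDiff_inv_glpos (m : ℕ) :
    ContMDiff 𝓘(ℝ, Fin m → Fin m → ℝ) 𝓘(ℝ, Fin m → Fin m → ℝ) ∞
      (fun T : GL(m, ℝ)⁺ => T⁻¹) := by
  refine ContMDiff.of_comp_isOpenEmbedding (isOpenEmbedding_mat m) ?_
  have inv_smooth : ContDiffOn ℝ ∞
      (fun (B : Fin m → Fin m → ℝ) i j => (of B)⁻¹ i j) {B | (of B).det ≠ 0} :=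
    contDiffOn_pi.2 fun i => contDiffOn_pi.2 fun j =>
      contDiffOn_matrix_inv (fun k l => by simp only [of_apply]; fun_prop) (fun _ hB => hB) i j
  refine (inv_smooth.contMDiffOn.comp_contMDiff (contMDiff_mat m) fun T =>
    (det_mat_pos T).ne').congr fun T => ?_
  exact mat_inv T

end GLPos

section MovingFrame

variable {EN HN EP HP : Type*}
  [NormedAddCommGroup EN] [NormedSpace ℝ EN] [TopologicalSpace HN]
  [NormedAddCommGroup EP] [NormedSpace ℝ EP] [TopologicalSpace HP]
  {m : ℕ} {N P : Type*} [TopologicalSpace N] [ChartedSpace HN N] [MulAction (GL(m, ℝ)⁺) N]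
  [TopologicalSpace P] [ChartedSpace HP P]
  {IN : ModelWithCorners ℝ EN HN} {IP : ModelWithCorners ℝ EP HP}
  {F : N → Matrix (Fin m) (Fin m) ℝ} {D : Matrix (Fin m) (Fin m) ℝ}

/-- An equivariant smooth map from a manifold with an action of `GL⁺(m, ℝ)` to the invertible
matrices, on which `GL⁺(m, ℝ)` acts by left translations. -/
structure IsMovingFrame (IN : ModelWithCorners ℝ EN HN) (F : N → Matrix (Fin m) (Fin m) ℝ) :
    Prop where
  contMDiff : ContMDiff IN 𝓘(ℝ, Fin m → Fin m → ℝ) ∞ fun x i j => F x i j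
  det_ne_zero : ∀ x, (F x).det ≠ 0
  map_smul : ∀ (T : GL(m, ℝ)⁺) x, F (T • x) = mat T * F x

/-- The representative, `1` or `D`, of the component of the invertible matrices in which `B` lies.
It is meaningful when `D` has negative determinant. -/
def signRep (D B : Matrix (Fin m) (Fin m) ℝ) : Matrix (Fin m) (Fin m) ℝ :=
  if 0 < B.det then 1 else D

theorem signRep_mat_mul (T : GL(m, ℝ)⁺) (B : Matrix (Fin m) (Fin m) ℝ) :
    signRep D (mat T * B) = signRep D B := by
  simp only [signRep, det_mul, mul_pos_iff_of_pos_left (det_mat_pos T)]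

theorem signRep_eq_self (hD : D.det < 0) {B : Matrix (Fin m) (Fin m) ℝ} (hB : B = 1 ∨ B = D) :
    signRep D B = B := by
  rcases hB with rfl | rfl
  · simp [signRep]
  · simp [signRep, hD.le]

theorem signRep_eq_one_or (D B : Matrix (Fin m) (Fin m) ℝ) :
    signRep D B = 1 ∨ signRep D B = D := by
  rw [signRep]
  split_ifs
  exacts [.inl rfl, .inr rfl]

theorem isUnit_det_signRep (hD : D.det < 0) (B : Matrix (Fin m) (Fin m) ℝ) :
    IsUnit (signRep D B).det := by
  rw [isUnit_iff_ne_zero]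
  rcases signRep_eq_one_or D B with h | h <;> rw [h]
  · simp
  · exact hD.ne

theorem det_mul_signRep_inv_pos (hD : D.det < 0) {B : Matrix (Fin m) (Fin m) ℝ}
    (hB : B.det ≠ 0) : 0 < (B * (signRep D B)⁻¹).det := by
  rw [det_mul, det_nonsing_inv, Ring.inverse_eq_inv', signRep]
  split_ifs with h
  · simpa using h
  · exact mul_pos_of_neg_of_neg (hB.lt_of_le (not_lt.1 h)) (inv_lt_zero.2 hD)

namespace IsMovingFrame

/-- The moving frame `F`, corrected by the representative of its orientation so that it takes values
in `GL⁺(m, ℝ)`. -/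
def oriented (hF : IsMovingFrame IN F) (hD : D.det < 0) (x : N) : GL(m, ℝ)⁺ :=
  toGLPos (F x * (signRep D (F x))⁻¹) (det_mul_signRep_inv_pos hD (hF.det_ne_zero x))

theorem oriented_smul (hF : IsMovingFrame IN F) (hD : D.det < 0) (T : GL(m, ℝ)⁺) (x : N) :
    hF.oriented hD (T • x) = T * hF.oriented hD x :=
  mat_injective <| by
    simp only [oriented, mat_mul, mat_toGLPos, hF.map_smul, signRep_mat_mul, mul_assoc]

theorem oriented_eq_one (hF : IsMovingFrame IN F) (hD : D.det < 0) {x : N}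
    (hx : F x = 1 ∨ F x = D) : hF.oriented hD x = 1 :=
  mat_injective <| by
    rw [oriented, mat_toGLPos, signRep_eq_self hD hx, mat_one,
      mul_nonsing_inv _ (hF.det_ne_zero x).isUnit]

theorem map_oriented_inv_smul (hF : IsMovingFrame IN F) (hD : D.det < 0) (x : N) :
    F ((hF.oriented hD x)⁻¹ • x) = signRep D (F x) := by
  rw [hF.map_smul, mat_inv, oriented, mat_toGLPos, Matrix.mul_inv_rev,
    nonsing_inv_nonsing_inv _ (isUnit_det_signRep hD _),
    nonsing_inv_mul_cancel_right _ _ (hF.det_ne_zero x).isUnit]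

theorem isClopen_det_pos (hF : IsMovingFrame IN F) : IsClopen {x | 0 < (F x).det} := by
  have hdet : Continuous fun x => (F x).det := Continuous.matrix_det hF.contMDiff.continuous
  have hle : {x | 0 < (F x).det} = {x | 0 ≤ (F x).det} :=
    Set.ext fun x => (hF.det_ne_zero x).symm.le_iff_lt.symm
  exact ⟨hle ▸ isClosed_le continuous_const hdet, isOpen_lt continuous_const hdet⟩

theorem contMDiff_ite_det_pos (hF : IsMovingFrame IN F) {f g : N → P} (hf : ContMDiff IN IP ∞ f)
    (hg : ContMDiff IN IP ∞ g) : ContMDiff IN IP ∞ fun x => if 0 < (F x).det then f x else g x :=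
  ContMDiff.piecewise (s := {x | 0 < (F x).det}) hf hg fun x hx => by
    simp [hF.isClopen_det_pos.frontier_eq] at hx

theorem contMDiff_oriented (hF : IsMovingFrame IN F) (hD : D.det < 0) :
    ContMDiff IN 𝓘(ℝ, Fin m → Fin m → ℝ) ∞ (hF.oriented hD) := by
  refine ContMDiff.of_comp_isOpenEmbedding (isOpenEmbedding_mat m) ?_
  have mul_smooth (C : Matrix (Fin m) (Fin m) ℝ) :
      ContMDiff IN 𝓘(ℝ, Fin m → Fin m → ℝ) ∞ fun x i j => (F x * C) i j := by
    have : ContDiff ℝ ∞ fun (B : Fin m → Fin m → ℝ) i j => ∑ k, B i k * C k j := by fun_prop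
    exact this.contMDiff.comp hF.contMDiff
  refine (hF.contMDiff_ite_det_pos (mul_smooth 1⁻¹) (mul_smooth D⁻¹)).congr fun x => ?_
  simp only [Function.comp_apply, oriented, mat_toGLPos, signRep]
  split_ifs <;> rfl

variable {σ : N → N}

/-- The point of the orbit of `x` with moving frame `1` or, if the frames along that orbit are
negatively oriented, the image under `σ` of its point with moving frame `D`. It lies on `{F = 1}`
for an involution `σ` with `F (σ x) = D * F x`. -/
def normalForm (hF : IsMovingFrame IN F) (hD : D.det < 0) (σ : N → N) (x : N) : N :=
  if 0 < (F x).det then (hF.oriented hD x)⁻¹ • x else σ ((hF.oriented hD x)⁻¹ • x)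

theorem map_normalForm (hF : IsMovingFrame IN F) (hD : D.det < 0) (hσ : ∀ x, F (σ x) = D * F x)
    (hσσ : Function.Involutive σ) (x : N) : F (hF.normalForm hD σ x) = 1 := by
  have hsign := hF.map_oriented_inv_smul hD x
  rw [normalForm]
  rw [signRep] at hsign
  split_ifs at hsign ⊢
  · exact hsign
  · have h := hσ (σ ((hF.oriented hD x)⁻¹ • x))
    rw [hσσ, hsign] at h
    rw [← nonsing_inv_mul_cancel_left D (F _) hD.ne.isUnit, ← h, nonsing_inv_mul D hD.ne.isUnit]

theorem det_map_smul_pos_iff (hF : IsMovingFrame IN F) (T : GL(m, ℝ)⁺) (x : N) :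
    0 < (F (T • x)).det ↔ 0 < (F x).det := by
  rw [hF.map_smul, det_mul, mul_pos_iff_of_pos_left (det_mat_pos T)]

theorem normalForm_smul (hF : IsMovingFrame IN F) (hD : D.det < 0) (T : GL(m, ℝ)⁺) (x : N) :
    hF.normalForm hD σ (T • x) = hF.normalForm hD σ x := by
  simp only [normalForm, hF.det_map_smul_pos_iff, hF.oriented_smul, _root_.mul_inv_rev, mul_smul,
    inv_smul_smul]

theorem normalForm_eq_self (hF : IsMovingFrame IN F) (hD : D.det < 0) {x : N} (hx : F x = 1) :
    hF.normalForm hD σ x = x := by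
  simp [normalForm, hx, hF.oriented_eq_one hD (.inl hx)]

theorem normalForm_apply_eq_self (hF : IsMovingFrame IN F) (hD : D.det < 0)
    (hσ : ∀ x, F (σ x) = D * F x) (hσσ : Function.Involutive σ) {x : N} (hx : F x = 1) :
    hF.normalForm hD σ (σ x) = x := by
  have hσx : F (σ x) = D := by rw [hσ, hx, mul_one]
  simp [normalForm, hσx, hD.not_gt, hF.oriented_eq_one hD (.inr hσx), hσσ x]

theorem contMDiff_normalForm (hF : IsMovingFrame IN F) (hD : D.det < 0)
    (hsmul : ContMDiff (𝓘(ℝ, Fin m → Fin m → ℝ).prod IN) IN ∞ fun x : GL(m, ℝ)⁺ × N => x.1 • x.2)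
    (hσ : ContMDiff IN IN ∞ σ) : ContMDiff IN IN ∞ (hF.normalForm hD σ) := by
  have hnorm : ContMDiff IN IN ∞ fun x => (hF.oriented hD x)⁻¹ • x :=
    hsmul.comp (((contMDiff_inv_glpos m).comp (hF.contMDiff_oriented hD)).prodMk contMDiff_id)
  exact hF.contMDiff_ite_det_pos hnorm (hσ.comp hnorm)

/-- The second sheet of the slice, in the level `{F = D}`, takes care of the negatively oriented
frames. -/
theorem exists_isGlobalSlice (hF : IsMovingFrame IN F) (hD : D.det < 0)
    (hsmul : ContMDiff (𝓘(ℝ, Fin m → Fin m → ℝ).prod IN) IN ∞ fun x : GL(m, ℝ)⁺ × N => x.1 • x.2)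
    (hσ_smooth : ContMDiff IN IN ∞ σ) (hσ : ∀ x, F (σ x) = D * F x)
    (hσσ : Function.Involutive σ) {Ω : TopologicalSpace.Opens P} {s : Ω → N} {r : N → P}
    (hs_smooth : ContMDiff IP IN ∞ s) (hr : ContMDiff IN IP ∞ r) (hrs : ∀ b, r (s b) = b)
    (hs : Set.range s = {x | F x = 1}) :
    ∃ (q : N → Ω ⊕ Ω) (φ : N → GL(m, ℝ)⁺),
      IsGlobalSlice 𝓘(ℝ, Fin m → Fin m → ℝ) IN IP (Sum.elim s (σ ∘ s)) q φ := by
  have hFs (b : Ω) : F (s b) = 1 := hs.subset ⟨b, rfl⟩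
  have hFσs (b : Ω) : F (σ (s b)) = D := by rw [hσ, hFs, mul_one]
  have hlevel : ∀ b : Ω ⊕ Ω, F (Sum.elim s (σ ∘ s) b) = 1 ∨ F (Sum.elim s (σ ∘ s) b) = D :=
    Sum.rec (fun b => .inl (hFs b)) fun b => .inr (hFσs b)
  have hs_inj : Function.Injective s := fun b c h => Subtype.ext (by rw [← hrs, h, hrs])
  choose q₀ hq₀ using fun x => hs.superset (hF.map_normalForm hD hσ hσσ x)
  have hq₀_smooth : ContMDiff IN IP ∞ q₀ :=
    (ContMDiff.subtypeVal_comp_iff Ω q₀).1 <|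
      (hr.comp (hF.contMDiff_normalForm hD hsmul hσ_smooth)).congr fun x =>
        (hrs (q₀ x)).symm.trans (congrArg r (hq₀ x))
  refine ⟨fun x => if 0 < (F x).det then .inl (q₀ x) else .inr (q₀ x), hF.oriented hD, hsmul,
    hs_smooth.sumElim (hσ_smooth.comp hs_smooth), hF.contMDiff_ite_det_pos
      (ContMDiff.inl.comp hq₀_smooth) (ContMDiff.inr.comp hq₀_smooth), hF.contMDiff_oriented hD,
    fun x => ?smul_section, fun g => ?proj_smul_section, fun g b => ?frame_smul_section⟩
  case smul_section =>
    have hx := hq₀ x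
    rw [normalForm] at hx
    split_ifs at hx ⊢
    · exact (congrArg _ hx).trans (smul_inv_smul _ _)
    · simp [hx, hσσ _]
  case proj_smul_section =>
    simp only [hF.det_map_smul_pos_iff]
    rintro (b | b)
    · simp only [Sum.elim_inl, hFs, det_one, zero_lt_one, if_true]
      exact congrArg _ (hs_inj (by rw [hq₀, hF.normalForm_smul, hF.normalForm_eq_self hD (hFs b)]))
    · simp only [Sum.elim_inr, Function.comp_apply, hFσs, hD.not_gt, if_false]
      exact congrArg _ (hs_inj (by
        rw [hq₀, hF.normalForm_smul, hF.normalForm_apply_eq_self hD hσ hσσ (hFs b)]))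
  case frame_smul_section =>
    rw [hF.oriented_smul, hF.oriented_eq_one hD (hlevel b), mul_one]

end IsMovingFrame

end MovingFrame

/-! ### Invariants of Christoffel symbols -/

section BilinearForm

variable {R ι κ : Type*} [CommRing R] [Fintype ι] [Fintype κ]

theorem matrix_eq_of_dotProduct {B C : Matrix ι κ R} (h : ∀ x y, x ⬝ᵥ B *ᵥ y = x ⬝ᵥ C *ᵥ y) :
    B = C := by
  classical
  ext i j
  simpa using h (Pi.single i 1) (Pi.single j 1)

theorem dotProduct_transpose_mul_mul (N : Matrix κ ι R) (B : Matrix κ κ R) (x y : ι → R) :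
    x ⬝ᵥ (Nᵀ * B * N) *ᵥ y = (N *ᵥ x) ⬝ᵥ B *ᵥ (N *ᵥ y) := by
  rw [← mulVec_mulVec, ← mulVec_mulVec, dotProduct_mulVec, vecMul_transpose]

end BilinearForm

section Algebra

variable {m : ℕ} {A : Type*} [CommRing A]

/-- The operator `Γ(x, ·)`. -/
def leftMul (Γ : Fin m → Fin m → Fin m → A) (x : Fin m → A) : Matrix (Fin m) (Fin m) A :=
  of fun k b => ∑ a, x a * Γ a b k

/-- The operator `Γ(·, y)`. -/
def rightMul (Γ : Fin m → Fin m → Fin m → A) (y : Fin m → A) : Matrix (Fin m) (Fin m) A :=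
  leftMul (fun i j => Γ j i) y

/-- The covector `ω_j = Γ_{ij}^i`. -/
def contraction (Γ : Fin m → Fin m → Fin m → A) : Fin m → A :=
  fun j => ∑ i, Γ i j i

/-- The bilinear form `(x, y) ↦ ω (Γ(x, y))`. -/
def contractionForm (Γ : Fin m → Fin m → Fin m → A) : Matrix (Fin m) (Fin m) A :=
  of fun j k => ∑ n, contraction Γ n * Γ j k n

/-- The iterates `v, Γ(v, v), Γ(v, Γ(v, v)), …`. -/
def iterates (Γ : Fin m → Fin m → Fin m → A) (v : Fin m → A) (n : ℕ) : Fin m → A :=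
  leftMul Γ v ^ n *ᵥ v

/-- The matrix whose columns are the first `m` iterates `v, Γ(v, v), Γ(v, Γ(v, v)), …`. -/
def iterateMatrix (Γ : Fin m → Fin m → Fin m → A) (v : Fin m → A) : Matrix (Fin m) (Fin m) A :=
  of fun k i => iterates Γ v i k

/-- The change of coordinates of `Γ` by the matrix `M` with inverse `N`. -/
def changeCoord (M N : Matrix (Fin m) (Fin m) A) (Γ : Fin m → Fin m → Fin m → A) :
    Fin m → Fin m → Fin m → A :=
  fun i j k => ∑ a, ∑ b, ∑ c, N a i * N b j * M k c * Γ a b c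

variable (Γ : Fin m → Fin m → Fin m → A)

theorem leftMul_single (i j k : Fin m) : leftMul Γ (Pi.single i 1) k j = Γ i j k := by
  simp [leftMul, Pi.single_apply]

theorem iterates_zero (v : Fin m → A) : iterates Γ v 0 = v := by
  rw [iterates, pow_zero, one_mulVec]

theorem iterates_succ (v : Fin m → A) (n : ℕ) :
    iterates Γ v (n + 1) = leftMul Γ v *ᵥ iterates Γ v n := by
  rw [iterates, pow_succ', ← mulVec_mulVec, iterates]

theorem leftMul_mulVec_apply (x y : Fin m → A) (k : Fin m) :
    (leftMul Γ x *ᵥ y) k = ∑ a, ∑ b, x a * y b * Γ a b k := by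
  simp only [leftMul, mulVec, dotProduct, of_apply, Finset.sum_mul]
  rw [Finset.sum_comm]
  exact Finset.sum_congr rfl fun a _ => Finset.sum_congr rfl fun b _ => by ring

theorem leftMul_smul (c : A) (x : Fin m → A) : leftMul Γ (c • x) = c • leftMul Γ x := by
  ext k b
  simp [leftMul, Finset.mul_sum, mul_assoc]

theorem iterates_smul (c : A) (v : Fin m → A) (n : ℕ) :
    iterates Γ (c • v) n = c ^ (n + 1) • iterates Γ v n := by
  rw [iterates, leftMul_smul, smul_pow, smul_mulVec, mulVec_smul, smul_smul, ← pow_succ, iterates]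

theorem iterateMatrix_smul (c : A) (v : Fin m → A) :
    iterateMatrix Γ (c • v) = iterateMatrix Γ v * diagonal fun i : Fin m => c ^ ((i : ℕ) + 1) := by
  ext k i
  simp [iterateMatrix, iterates_smul, mul_comm]

theorem leftMul_changeCoord (M N : Matrix (Fin m) (Fin m) A) (x : Fin m → A) :
    leftMul (changeCoord M N Γ) x = M * leftMul Γ (N *ᵥ x) * N := by
  ext k j
  simp only [leftMul, changeCoord, mul_apply, mulVec, dotProduct, of_apply, Finset.mul_sum,
    Finset.sum_mul]
  rw [Finset.sum_comm, Finset.sum_congr rfl fun a _ => Finset.sum_comm, Finset.sum_comm]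
  refine Finset.sum_congr rfl fun b _ => ?_
  rw [Finset.sum_congr rfl fun a _ => Finset.sum_comm, Finset.sum_comm]
  exact Finset.sum_congr rfl fun c _ => Finset.sum_congr rfl fun a _ =>
    Finset.sum_congr rfl fun i _ => by ring

theorem changeCoord_swap (M N : Matrix (Fin m) (Fin m) A) :
    (fun i j => changeCoord M N Γ j i) = changeCoord M N fun i j => Γ j i := by
  funext i j k
  simp only [changeCoord]
  rw [Finset.sum_comm]
  exact Finset.sum_congr rfl fun a _ => Finset.sum_congr rfl fun b _ =>
    Finset.sum_congr rfl fun c _ => by ring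

theorem rightMul_changeCoord (M N : Matrix (Fin m) (Fin m) A) (y : Fin m → A) :
    rightMul (changeCoord M N Γ) y = M * rightMul Γ (N *ᵥ y) * N := by
  rw [rightMul, changeCoord_swap, leftMul_changeCoord, rightMul]

theorem leftMul_injective {Γ Γ' : Fin m → Fin m → Fin m → A}
    (h : ∀ x, leftMul Γ x = leftMul Γ' x) : Γ = Γ' := by
  funext i j k
  rw [← leftMul_single Γ, h, leftMul_single]

theorem changeCoord_changeCoord (M N M' N' : Matrix (Fin m) (Fin m) A) :
    changeCoord M N (changeCoord M' N' Γ) = changeCoord (M * M') (N' * N) Γ := by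
  refine leftMul_injective fun x => ?_
  simp only [leftMul_changeCoord, mulVec_mulVec, Matrix.mul_assoc]

theorem changeCoord_one : changeCoord 1 1 Γ = Γ := by
  refine leftMul_injective fun x => ?_
  simp [leftMul_changeCoord]

theorem trace_rightMul (y : Fin m → A) : (rightMul Γ y).trace = contraction Γ ⬝ᵥ y := by
  simp only [rightMul, leftMul, trace, diag_apply, of_apply, contraction, dotProduct,
    Finset.sum_mul]
  rw [Finset.sum_comm]
  exact Finset.sum_congr rfl fun a _ => Finset.sum_congr rfl fun b _ => mul_comm _ _

theorem dotProduct_contractionForm (x y : Fin m → A) :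
    x ⬝ᵥ contractionForm Γ *ᵥ y = contraction Γ ⬝ᵥ (leftMul Γ x *ᵥ y) := by
  simp only [contractionForm, leftMul, mulVec, dotProduct, of_apply, Finset.sum_mul,
    Finset.mul_sum]
  rw [Finset.sum_congr rfl fun a _ => Finset.sum_comm, Finset.sum_comm]
  refine Finset.sum_congr rfl fun n _ => ?_
  rw [Finset.sum_comm]
  exact Finset.sum_congr rfl fun a _ => Finset.sum_congr rfl fun b _ => by ring

theorem trace_leftMul_mul_rightMul (x y : Fin m → A) :
    (leftMul Γ x * rightMul Γ y).trace =
      x ⬝ᵥ (of fun j k => ∑ i, ∑ n, Γ j n i * Γ i k n : Matrix (Fin m) (Fin m) A) *ᵥ y := by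
  simp only [rightMul, leftMul, mul_apply, trace, diag_apply, mulVec, dotProduct, of_apply,
    Finset.sum_mul, Finset.mul_sum]
  rw [Finset.sum_congr rfl fun i _ => (Finset.sum_congr rfl fun n _ => Finset.sum_comm).trans
    Finset.sum_comm, Finset.sum_comm]
  refine Finset.sum_congr rfl fun a _ => ?_
  rw [Finset.sum_congr rfl fun i _ => Finset.sum_comm, Finset.sum_comm]
  exact Finset.sum_congr rfl fun b _ => Finset.sum_congr rfl fun i _ =>
    Finset.sum_congr rfl fun n _ => by ring

theorem ricci_eq : ricci Γ = contractionForm Γ - of fun j k => ∑ i, ∑ n, Γ j n i * Γ i k n := by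
  ext j k
  simp only [ricci, contractionForm, contraction, of_apply, Matrix.sub_apply, Finset.sum_mul]
  rw [Finset.sum_comm]

theorem dotProduct_ricci (x y : Fin m → A) :
    x ⬝ᵥ ricci Γ *ᵥ y =
      contraction Γ ⬝ᵥ (leftMul Γ x *ᵥ y) - (leftMul Γ x * rightMul Γ y).trace := by
  rw [ricci_eq, sub_mulVec, dotProduct_sub, dotProduct_contractionForm,
    trace_leftMul_mul_rightMul]

variable {Γ} {M N : Matrix (Fin m) (Fin m) A}

theorem contraction_changeCoord (hNM : N * M = 1) :
    contraction (changeCoord M N Γ) = contraction Γ ᵥ* N := by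
  refine dotProduct_eq _ _ fun y => ?_
  rw [← trace_rightMul, rightMul_changeCoord, Matrix.mul_assoc, trace_mul_comm,
    Matrix.mul_assoc, hNM, Matrix.mul_one, trace_rightMul, dotProduct_mulVec]

theorem contraction_dotProduct_leftMul_changeCoord (hNM : N * M = 1) (x y : Fin m → A) :
    contraction (changeCoord M N Γ) ⬝ᵥ (leftMul (changeCoord M N Γ) x *ᵥ y) =
      contraction Γ ⬝ᵥ (leftMul Γ (N *ᵥ x) *ᵥ (N *ᵥ y)) := by
  rw [contraction_changeCoord hNM, leftMul_changeCoord, ← dotProduct_mulVec, mulVec_mulVec,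
    Matrix.mul_assoc, ← Matrix.mul_assoc N M, hNM, Matrix.one_mul, mulVec_mulVec]

theorem contractionForm_changeCoord (hNM : N * M = 1) :
    contractionForm (changeCoord M N Γ) = Nᵀ * contractionForm Γ * N := by
  refine matrix_eq_of_dotProduct fun x y => ?_
  rw [dotProduct_transpose_mul_mul, dotProduct_contractionForm, dotProduct_contractionForm,
    contraction_dotProduct_leftMul_changeCoord hNM]

theorem ricci_changeCoord (hNM : N * M = 1) : ricci (changeCoord M N Γ) = Nᵀ * ricci Γ * N := by
  refine matrix_eq_of_dotProduct fun x y => ?_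
  rw [dotProduct_transpose_mul_mul, dotProduct_ricci, dotProduct_ricci,
    contraction_dotProduct_leftMul_changeCoord hNM, leftMul_changeCoord, rightMul_changeCoord]
  congr 1
  rw [Matrix.mul_assoc, trace_mul_comm]
  simp only [Matrix.mul_assoc]
  rw [← Matrix.mul_assoc N M, ← Matrix.mul_assoc N M, hNM, Matrix.one_mul, Matrix.one_mul,
    trace_mul_comm]

theorem symRicci_changeCoord [Algebra ℝ A] (hNM : N * M = 1) :
    symRicci (changeCoord M N Γ) = Nᵀ * symRicci Γ * N := by
  simp only [symRicci, ricci_changeCoord hNM, transpose_mul, transpose_transpose,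
    Matrix.mul_smul, Matrix.smul_mul, Matrix.mul_add, Matrix.add_mul, Matrix.mul_assoc]

theorem iterates_changeCoord (hNM : N * M = 1) (v : Fin m → A) (n : ℕ) :
    iterates (changeCoord M N Γ) (M *ᵥ v) n = M *ᵥ iterates Γ v n := by
  have hconj : SemiconjBy M (leftMul Γ v) (leftMul (changeCoord M N Γ) (M *ᵥ v)) := by
    rw [SemiconjBy, leftMul_changeCoord, mulVec_mulVec, hNM, one_mulVec, Matrix.mul_assoc, hNM,
      Matrix.mul_one]
  rw [iterates, iterates, mulVec_mulVec, mulVec_mulVec, (hconj.pow_right n).eq]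

theorem iterateMatrix_changeCoord (hNM : N * M = 1) (v : Fin m → A) :
    iterateMatrix (changeCoord M N Γ) (M *ᵥ v) = M * iterateMatrix Γ v := by
  ext k i
  simp only [iterateMatrix, of_apply, iterates_changeCoord hNM, mul_apply, mulVec, dotProduct]

/-- The vector `v` with `ω (Γ(v, ·)) = ω`; it is meaningful when the form `ω (Γ(·, ·))` is
nondegenerate. -/
def distinguishedVector (Γ : Fin m → Fin m → Fin m → A) : Fin m → A :=
  contraction Γ ᵥ* (contractionForm Γ)⁻¹

/-- The frame `v, Γ(v, v), Γ(v, Γ(v, v)), …`, where `ω (Γ(v, ·)) = ω`, as a matrix of columns. -/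
def frame (Γ : Fin m → Fin m → Fin m → A) : Matrix (Fin m) (Fin m) A :=
  iterateMatrix Γ (distinguishedVector Γ)

theorem distinguishedVector_changeCoord (hNM : N * M = 1) :
    distinguishedVector (changeCoord M N Γ) = M *ᵥ distinguishedVector Γ := by
  have hMN : M * N = 1 := mul_eq_one_comm.1 hNM
  rw [distinguishedVector, distinguishedVector, contraction_changeCoord hNM,
    contractionForm_changeCoord hNM, Matrix.mul_inv_rev, Matrix.mul_inv_rev, inv_eq_left_inv hMN,
    ← transpose_nonsing_inv, inv_eq_left_inv hMN, vecMul_vecMul, ← Matrix.mul_assoc, hNM,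
    Matrix.one_mul, ← vecMul_vecMul, vecMul_transpose]

theorem frame_changeCoord (hNM : N * M = 1) : frame (changeCoord M N Γ) = M * frame Γ := by
  rw [frame, distinguishedVector_changeCoord hNM, iterateMatrix_changeCoord hNM, frame]

end Algebra

/-! ### Genericity and the signature -/

section Naturality

variable {m : ℕ} {A B : Type*} [CommRing A] [CommRing B] (f : A →+* B)
  (Γ : Fin m → Fin m → Fin m → A)

theorem map_contraction :
    contraction (fun i j k => f (Γ i j k)) = fun j => f (contraction Γ j) := by
  funext j
  simp [contraction]

theorem map_contractionForm :
    contractionForm (fun i j k => f (Γ i j k)) = (contractionForm Γ).map f := by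
  ext j k
  simp [contractionForm, map_contraction]

theorem map_leftMul (x : Fin m → A) :
    leftMul (fun i j k => f (Γ i j k)) (fun j => f (x j)) = (leftMul Γ x).map f := by
  ext k b
  simp [leftMul]

theorem map_iterateMatrix (v : Fin m → A) :
    iterateMatrix (fun i j k => f (Γ i j k)) (fun j => f (v j)) = (iterateMatrix Γ v).map f := by
  ext k i
  have hpow : (leftMul Γ v).map f ^ (i : ℕ) = (leftMul Γ v ^ (i : ℕ)).map f :=
    (map_pow f.mapMatrix (leftMul Γ v) i).symm
  simp only [iterateMatrix, iterates, of_apply, Matrix.map_apply, map_leftMul, hpow]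
  exact (f.map_mulVec _ v k).symm

theorem map_vecMul_adjugate (C : Matrix (Fin m) (Fin m) A) (w : Fin m → A) :
    (fun j => f (w j)) ᵥ* (C.map f).adjugate = fun j => f ((w ᵥ* C.adjugate) j) := by
  funext j
  have h : (C.map f).adjugate = C.adjugate.map f := (f.map_adjugate C).symm
  rw [h]
  exact (f.map_vecMul _ w j).symm

theorem map_det_symRicci [Algebra ℝ A] [Algebra ℝ B] (f : A →ₐ[ℝ] B) :
    (symRicci fun i j k => f (Γ i j k)).det = f (symRicci Γ).det := by
  have hmap : (symRicci fun i j k => f (Γ i j k)) = (symRicci Γ).map f := by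
    ext j k
    simp [symRicci, ricci]
  rw [hmap]
  exact (f.map_det _).symm

/-- The product of the determinant of the form `ω (Γ(·, ·))` and of the determinant of the frame
generated by the distinguished vector. To obtain a polynomial in `Γ`, the distinguished vector is
rescaled by the former determinant. -/
def frameDiscriminant (Γ : Fin m → Fin m → Fin m → A) : A :=
  (contractionForm Γ).det *
    (iterateMatrix Γ (contraction Γ ᵥ* (contractionForm Γ).adjugate)).det

theorem map_frameDiscriminant :
    frameDiscriminant (fun i j k => f (Γ i j k)) = f (frameDiscriminant Γ) := by
  have hdet (C : Matrix (Fin m) (Fin m) A) : (C.map f).det = f C.det := (f.map_det C).symm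
  rw [frameDiscriminant, frameDiscriminant, map_contraction, map_contractionForm,
    map_vecMul_adjugate, map_iterateMatrix, hdet, hdet, map_mul]

end Naturality

section Genericity

variable {m : ℕ}

/-- The frame discriminant as a polynomial on `𝒲(m)`. -/
def frameDiscriminantPoly (m : ℕ) : WPoly m :=
  frameDiscriminant fun i j k => MvPolynomial.X (i, j, k)

/-- The polynomial `𝔓_m` of the theorem. -/
def genericityPoly (m : ℕ) : WPoly m := detSymRicciPoly m * frameDiscriminantPoly m

theorem evalAt_detSymRicciPoly (Γ : W m) : (detSymRicciPoly m).evalAt Γ = (symRicci Γ).det := by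
  have h := map_det_symRicci (fun i j k => (MvPolynomial.X (i, j, k) : WPoly m))
    (MvPolynomial.aeval (R := ℝ) fun x : Fin m × Fin m × Fin m => Γ x.1 x.2.1 x.2.2)
  simp only [MvPolynomial.aeval_X, MvPolynomial.aeval_eq_eval] at h
  exact h.symm

theorem evalAt_frameDiscriminantPoly (Γ : W m) :
    (frameDiscriminantPoly m).evalAt Γ = frameDiscriminant Γ := by
  have h := map_frameDiscriminant
    (MvPolynomial.eval (R := ℝ) fun x : Fin m × Fin m × Fin m => Γ x.1 x.2.1 x.2.2)
    (fun i j k => (MvPolynomial.X (i, j, k) : WPoly m))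
  simp only [MvPolynomial.eval_X] at h
  exact h.symm

/-- The symbols with nondegenerate `ρ_s` and `ω (Γ(·, ·))` for which the distinguished vector
generates a frame. -/
structure IsGeneric (Γ : W m) : Prop where
  det_symRicci_ne_zero : (symRicci Γ).det ≠ 0
  det_contractionForm_ne_zero : (contractionForm Γ).det ≠ 0
  det_frame_ne_zero : (frame Γ).det ≠ 0

theorem det_iterateMatrix_adjugate_ne_zero_iff {Γ : W m} (h : (contractionForm Γ).det ≠ 0) :
    (iterateMatrix Γ (contraction Γ ᵥ* (contractionForm Γ).adjugate)).det ≠ 0 ↔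
      (frame Γ).det ≠ 0 := by
  have hv : contraction Γ ᵥ* (contractionForm Γ).adjugate =
      (contractionForm Γ).det • distinguishedVector Γ := by
    rw [distinguishedVector, inv_def, Ring.inverse_eq_inv', vecMul_smul, smul_smul,
      mul_inv_cancel₀ h, one_smul]
  have hscale : ∏ i : Fin m, (contractionForm Γ).det ^ ((i : ℕ) + 1) ≠ 0 :=
    Finset.prod_ne_zero_iff.2 fun i _ => pow_ne_zero _ h
  rw [hv, iterateMatrix_smul, det_mul, det_diagonal, frame, mul_ne_zero_iff_right hscale]

theorem evalAt_genericityPoly_ne_zero_iff (Γ : W m) :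
    (genericityPoly m).evalAt Γ ≠ 0 ↔ IsGeneric Γ := by
  have heval : (genericityPoly m).evalAt Γ = (symRicci Γ).det * frameDiscriminant Γ := by
    rw [← evalAt_detSymRicciPoly, ← evalAt_frameDiscriminantPoly]
    exact map_mul _ _ _
  rw [heval, frameDiscriminant, mul_ne_zero_iff, mul_ne_zero_iff]
  constructor
  · rintro ⟨hρ, hβ, hf⟩
    exact ⟨hρ, hβ, (det_iterateMatrix_adjugate_ne_zero_iff hβ).1 hf⟩
  · rintro ⟨hρ, hβ, hf⟩
    exact ⟨hρ, hβ, (det_iterateMatrix_adjugate_ne_zero_iff hβ).2 hf⟩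

theorem IsGeneric.changeCoord {Γ : W m} (h : IsGeneric Γ) {M N : Matrix (Fin m) (Fin m) ℝ}
    (hNM : N * M = 1) : IsGeneric (changeCoord M N Γ) := by
  have hdet : N.det * M.det = 1 := by rw [← det_mul, hNM, det_one]
  have hN : N.det ≠ 0 := left_ne_zero_of_mul_eq_one hdet
  have hM : M.det ≠ 0 := right_ne_zero_of_mul_eq_one hdet
  constructor
  · rw [symRicci_changeCoord hNM, det_mul, det_mul, det_transpose]
    exact mul_ne_zero (mul_ne_zero hN h.det_symRicci_ne_zero) hN
  · rw [contractionForm_changeCoord hNM, det_mul, det_mul, det_transpose]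
    exact mul_ne_zero (mul_ne_zero hN h.det_contractionForm_ne_zero) hN
  · rw [frame_changeCoord hNM, det_mul]
    exact mul_ne_zero hM h.det_frame_ne_zero

end Genericity

section Signature

theorem toQuadraticForm_apply {ι R : Type*} [Fintype ι] [DecidableEq ι] [CommRing R]
    (B : Matrix ι ι R) (x : ι → R) : B.toQuadraticForm' x = x ⬝ᵥ B *ᵥ x := by
  simp [Matrix.toQuadraticForm', Matrix.toLinearMap₂'_apply']

theorem toQuadraticForm_congruent_equivalent {ι κ R : Type*} [Fintype ι] [DecidableEq ι]
    [Fintype κ] [DecidableEq κ] [CommRing R] (B : Matrix κ κ R) {M : Matrix ι κ R}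
    {N : Matrix κ ι R} (hNM : N * M = 1) (hMN : M * N = 1) :
    QuadraticMap.Equivalent (Nᵀ * B * N).toQuadraticForm' B.toQuadraticForm' := by
  refine ⟨⟨LinearEquiv.ofLinearMap (toLin' N) (toLin' M) ?_ ?_, fun x => ?_⟩⟩
  · rw [← toLin'_mul, hNM, toLin'_one]
  · rw [← toLin'_mul, hMN, toLin'_one]
  · change B.toQuadraticForm' (toLin' N x) = _
    rw [toQuadraticForm_apply, toQuadraticForm_apply, dotProduct_transpose_mul_mul, toLin'_apply]

theorem HasRicciSignature.changeCoord {m p q : ℕ} {Γ : W m} (h : HasRicciSignature p q Γ)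
    {M N : Matrix (Fin m) (Fin m) ℝ} (hNM : N * M = 1) :
    HasRicciSignature p q (changeCoord M N Γ) := by
  rw [HasRicciSignature, symRicci_changeCoord hNM]
  have e := toQuadraticForm_congruent_equivalent (symRicci Γ) hNM (mul_eq_one_comm.1 hNM)
  exact ⟨e.sigNeg_eq.trans h.1, e.sigPos_eq.trans h.2⟩

theorem posDef_restrict_iff_sphere {E : Type*} [NormedAddCommGroup E] [NormedSpace ℝ E]
    (Q : QuadraticForm ℝ E) (V : Submodule ℝ E) :
    (Q.restrict V).PosDef ↔ ∀ x ∈ Metric.sphere (0 : E) 1 ∩ V, 0 < Q x := by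
  constructor
  · rintro hQ x ⟨hx, hxV⟩
    refine hQ ⟨x, hxV⟩ fun h => ?_
    have hx0 : x = 0 := congrArg Subtype.val h
    rw [mem_sphere_zero_iff_norm, hx0, norm_zero] at hx
    exact zero_ne_one hx
  · rintro hQ ⟨x, hxV⟩ hx
    have hnorm : ‖x‖ ≠ 0 := by simpa using hx
    have hpos := hQ (‖x‖⁻¹ • x) ⟨by simp [norm_smul, hnorm], V.smul_mem _ hxV⟩
    rw [QuadraticMap.map_smul] at hpos
    exact pos_of_mul_pos_right hpos (mul_self_nonneg _)

variable {Y ι : Type*} [TopologicalSpace Y] [Fintype ι] [DecidableEq ι] {B : Y → Matrix ι ι ℝ}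

theorem isOpen_posDef_restrict (hB : Continuous B) (V : Submodule ℝ (ι → ℝ)) :
    IsOpen {y | ((B y).toQuadraticForm'.restrict V).PosDef} := by
  have hcont : Continuous fun z : Y × (ι → ℝ) => z.2 ⬝ᵥ B z.1 *ᵥ z.2 :=
    continuous_snd.dotProduct ((hB.comp continuous_fst).matrix_mulVec continuous_snd)
  have hK : IsCompact (Metric.sphere (0 : ι → ℝ) 1 ∩ V) :=
    (isCompact_sphere _ _).inter_right V.closed_of_finiteDimensional
  simp only [posDef_restrict_iff_sphere, toQuadraticForm_apply]
  exact isOpen_iff_mem_nhds.2 fun y hy => hK.eventually_forall_of_forall_eventually fun x hx =>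
    (isOpen_lt continuous_const hcont).mem_nhds (hy x hx)

theorem isOpen_le_sigPos (hB : Continuous B) (q : ℕ) :
    IsOpen {y | q ≤ sigPos (B y).toQuadraticForm'} := by
  refine isOpen_iff_mem_nhds.2 fun y hy => ?_
  obtain ⟨V, hV, hpos⟩ := exists_finrank_eq_sigPos_and_posDef (B y).toQuadraticForm'
  filter_upwards [(isOpen_posDef_restrict hB V).mem_nhds hpos] with z hz
  exact hy.trans (hV ▸ le_sigPos_of_posDef _ hz)

theorem isOpen_le_sigNeg (hB : Continuous B) (p : ℕ) :
    IsOpen {y | p ≤ sigNeg (B y).toQuadraticForm'} := by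
  have hneg (y : Y) : (-B y).toQuadraticForm' = -(B y).toQuadraticForm' := by
    ext x
    simp [toQuadraticForm_apply, neg_mulVec]
  have h := isOpen_le_sigPos (B := fun y => -B y) hB.neg p
  simpa only [hneg, sigPos_neg] using h

variable {m p q : ℕ}

theorem continuous_symRicci (m : ℕ) : Continuous fun Γ : W m => symRicci Γ := by
  refine continuous_matrix fun j k => ?_
  simp only [symRicci, ricci, Matrix.smul_apply, Matrix.add_apply, Matrix.transpose_apply,
    Matrix.of_apply]
  fun_prop

theorem hasRicciSignature_iff_le (hpq : p + q = m) (Γ : W m) :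
    HasRicciSignature p q Γ ↔ p ≤ sigNeg (symRicci Γ).toQuadraticForm' ∧
      q ≤ sigPos (symRicci Γ).toQuadraticForm' := by
  have hle := QuadraticForm.sigPos_add_sigNeg_add_radical (Q := (symRicci Γ).toQuadraticForm')
  rw [Module.finrank_fin_fun] at hle
  rw [HasRicciSignature]
  omega

theorem isOpen_hasRicciSignature (hpq : p + q = m) :
    IsOpen {Γ : W m | HasRicciSignature p q Γ} := by
  simp only [hasRicciSignature_iff_le hpq]
  exact (isOpen_le_sigNeg (continuous_symRicci m) p).inter
    (isOpen_le_sigPos (continuous_symRicci m) q)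

theorem isOpen_wGen (hpq : p + q = m) (P : WPoly m) : IsOpen (WGen p q P) := by
  have hP : Continuous fun Γ : W m => P.evalAt Γ :=
    (MvPolynomial.continuous_eval P).comp (by fun_prop)
  exact (isOpen_hasRicciSignature hpq).inter (isOpen_ne_fun hP continuous_const)

end Signature

/-! ### Normalized symbols -/

theorem exists_affine_chart {X : Type*} [NormedAddCommGroup X] [NormedSpace ℝ X]
    [FiniteDimensional ℝ X] (S : AffineSubspace ℝ X) {x₀ : X} (hx₀ : x₀ ∈ S) :
    ∃ (d : ℕ) (r : X → EuclideanSpace ℝ (Fin d)) (ι : EuclideanSpace ℝ (Fin d) → X),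
      ContDiff ℝ ∞ r ∧ ContDiff ℝ ∞ ι ∧ Function.LeftInverse r ι ∧ (∀ u, ι u ∈ S) ∧
        Set.LeftInvOn ι r S := by
  obtain ⟨π, hπ⟩ := S.direction.subtype.exists_leftInverse_of_injective S.direction.ker_subtype
  have hπ (v : S.direction) : π v = v := LinearMap.congr_fun hπ v
  let e : S.direction ≃L[ℝ] EuclideanSpace ℝ (Fin (Module.finrank ℝ S.direction)) :=
    ContinuousLinearEquiv.ofFinrankEq finrank_euclideanSpace_fin.symm
  let π' : X →L[ℝ] S.direction := LinearMap.toContinuousLinearMap π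
  refine ⟨_, fun x => e (π' (x - x₀)), fun u => (e.symm u : S.direction) + x₀, by fun_prop, ?_,
    fun u => ?_, fun u => ?_, fun x hx => ?_⟩
  · exact (S.direction.subtypeL.contDiff.comp e.symm.contDiff).add contDiff_const
  · simp [π', hπ]
  · exact AffineSubspace.vadd_mem_of_mem_direction (e.symm u).2 hx₀
  · have hmem : x - x₀ ∈ S.direction := AffineSubspace.vsub_mem_direction hx hx₀
    have hπx : π' (x - x₀) = ⟨x - x₀, hmem⟩ := hπ ⟨x - x₀, hmem⟩
    simp [hπx]

section Normalized

variable {n : ℕ}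

/-- The affine conditions on `Γ` which, when the form `ω (Γ(·, ·))` is nondegenerate, say that the
frame of `Γ` is the standard basis: `Γ(e₀, eᵢ) = eᵢ₊₁` for `i < n`, the components of `Γ(e₀, eₙ)`
add up to `1`, and the components of `ω` agree. -/
structure IsNormalized (Γ : W (n + 1)) : Prop where
  zero_castSucc : ∀ i : Fin n, Γ 0 i.castSucc = Pi.single i.succ 1
  sum_zero_last : ∑ k, Γ 0 (Fin.last n) k = 1
  contraction_castSucc : ∀ i : Fin n, contraction Γ i.castSucc = contraction Γ i.succ

/-- The affine space of normalized symbols. -/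
def normalizedSymbols (n : ℕ) : AffineSubspace ℝ (W (n + 1)) where
  carrier := {Γ | IsNormalized Γ}
  smul_vsub_vadd_mem' c Γ₁ Γ₂ Γ₃ h₁ h₂ h₃ := by
    refine ⟨fun i => ?_, ?_, fun i => ?_⟩
    · simp [h₁.zero_castSucc, h₂.zero_castSucc, h₃.zero_castSucc]
    · simp [Finset.sum_add_distrib, ← Finset.mul_sum, h₁.sum_zero_last, h₂.sum_zero_last,
        h₃.sum_zero_last]
    · have hω (j : Fin (n + 1)) : contraction (c • (Γ₁ - Γ₂) + Γ₃) j =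
          c * (contraction Γ₁ j - contraction Γ₂ j) + contraction Γ₃ j := by
        simp [contraction, Finset.sum_add_distrib, ← Finset.mul_sum]
      simp only [vsub_eq_sub, vadd_eq_add, hω, h₁.contraction_castSucc, h₂.contraction_castSucc,
        h₃.contraction_castSucc]

theorem contraction_eq_contraction_zero {Γ : W (n + 1)}
    (h : ∀ i : Fin n, contraction Γ i.castSucc = contraction Γ i.succ) (j : Fin (n + 1)) :
    contraction Γ j = contraction Γ 0 := by
  induction j using Fin.induction with
  | zero => rfl
  | succ i ih => rw [← h i, ih]

theorem IsNormalized.iterates_eq {Γ : W (n + 1)} (h : IsNormalized Γ) (i : Fin (n + 1)) :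
    iterates Γ (Pi.single 0 1) i = Pi.single i 1 := by
  induction i using Fin.induction with
  | zero => exact iterates_zero Γ _
  | succ i ih =>
    rw [Fin.val_succ, iterates_succ, ← Fin.val_castSucc, ih]
    funext k
    simp [leftMul_single, h.zero_castSucc]

theorem IsNormalized.distinguishedVector_eq {Γ : W (n + 1)} (h : IsNormalized Γ)
    (hβ : (contractionForm Γ).det ≠ 0) : distinguishedVector Γ = Pi.single 0 1 := by
  have hω := contraction_eq_contraction_zero h.contraction_castSucc
  have hvec : (Pi.single 0 1 : Fin (n + 1) → ℝ) ᵥ* contractionForm Γ = contraction Γ := by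
    funext k
    rw [single_one_vecMul]
    change ∑ l, contraction Γ l * Γ 0 k l = _
    simp only [hω, ← Finset.mul_sum]
    induction k using Fin.lastCases with
    | last => rw [h.sum_zero_last, mul_one]
    | cast i => simp [h.zero_castSucc]
  rw [distinguishedVector, ← hvec, vecMul_vecMul, mul_nonsing_inv _ hβ.isUnit, vecMul_one]

theorem IsNormalized.frame_eq_one {Γ : W (n + 1)} (h : IsNormalized Γ)
    (hβ : (contractionForm Γ).det ≠ 0) : frame Γ = 1 := by
  ext k i
  rw [frame, h.distinguishedVector_eq hβ, iterateMatrix, of_apply, h.iterates_eq, one_apply,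
    Pi.single_apply]

theorem contraction_dotProduct_distinguishedVector {m : ℕ} {Γ : W m}
    (hβ : (contractionForm Γ).det ≠ 0) (y : Fin m → ℝ) :
    contraction Γ ⬝ᵥ (leftMul Γ (distinguishedVector Γ) *ᵥ y) = contraction Γ ⬝ᵥ y := by
  rw [← dotProduct_contractionForm, dotProduct_mulVec, distinguishedVector, vecMul_vecMul,
    nonsing_inv_mul _ hβ.isUnit, vecMul_one]

theorem distinguishedVector_of_frame_eq_one {Γ : W (n + 1)} (hF : frame Γ = 1) :
    distinguishedVector Γ = Pi.single 0 1 := by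
  funext k
  have h := congrFun (congrFun hF k) 0
  rwa [frame, iterateMatrix, of_apply, Fin.val_zero, iterates_zero, one_apply,
    ← Pi.single_apply] at h

theorem zero_castSucc_of_frame_eq_one {Γ : W (n + 1)} (hF : frame Γ = 1) (i : Fin n) :
    Γ 0 i.castSucc = Pi.single i.succ 1 := by
  have hiter (j : Fin (n + 1)) : iterates Γ (Pi.single 0 1) j = Pi.single j 1 := by
    funext k
    have h := congrFun (congrFun hF k) j
    rwa [frame, iterateMatrix, of_apply, distinguishedVector_of_frame_eq_one hF, one_apply,
      ← Pi.single_apply] at h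
  have h := hiter i.succ
  rw [Fin.val_succ, iterates_succ, ← Fin.val_castSucc, hiter] at h
  funext k
  simpa [leftMul_single] using congrFun h k

theorem isNormalized_of_frame_eq_one {Γ : W (n + 1)} (hβ : (contractionForm Γ).det ≠ 0)
    (hF : frame Γ = 1) : IsNormalized Γ := by
  have hv := distinguishedVector_of_frame_eq_one hF
  have hshift := zero_castSucc_of_frame_eq_one hF
  have hω (j : Fin (n + 1)) : ∑ l, contraction Γ l * Γ 0 j l = contraction Γ j := by
    have h := contraction_dotProduct_distinguishedVector hβ (Pi.single j 1)
    rw [hv, dotProduct_single_one] at h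
    simpa [dotProduct, leftMul_single] using h
  have hstep (i : Fin n) : contraction Γ i.castSucc = contraction Γ i.succ := by
    rw [← hω i.castSucc]
    simp [hshift, Pi.single_apply]
  have hconst := contraction_eq_contraction_zero hstep
  have hne : contraction Γ 0 ≠ 0 := by
    intro h0
    have hzero : contraction Γ = 0 := funext fun j => (hconst j).trans h0
    rw [distinguishedVector, hzero, zero_vecMul] at hv
    simpa using congrFun hv 0
  have hlast := hω (Fin.last n)
  simp only [hconst, ← Finset.mul_sum] at hlast
  exact ⟨hshift, mul_left_cancel₀ hne (hlast.trans (mul_one _).symm), hstep⟩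

theorem frame_eq_one_iff {Γ : W (n + 1)} (hβ : (contractionForm Γ).det ≠ 0) :
    frame Γ = 1 ↔ IsNormalized Γ :=
  ⟨isNormalized_of_frame_eq_one hβ, fun h => h.frame_eq_one hβ⟩

end Normalized

section Smooth

variable {E : Type*} [NormedAddCommGroup E] [NormedSpace ℝ E] {m : ℕ} {s : Set E} {r : ℕ∞ω}

theorem contDiffOn_frame {Γ : E → W m} (hΓ : ContDiffOn ℝ r Γ s)
    (hβ : ∀ x ∈ s, (contractionForm (Γ x)).det ≠ 0) (k i : Fin m) :
    ContDiffOn ℝ r (fun x => frame (Γ x) k i) s := by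
  have hentry (a b c : Fin m) : ContDiffOn ℝ r (fun x => Γ x a b c) s :=
    contDiffOn_pi.1 (contDiffOn_pi.1 (contDiffOn_pi.1 hΓ a) b) c
  have hω (j : Fin m) : ContDiffOn ℝ r (fun x => contraction (Γ x) j) s :=
    ContDiffOn.sum fun i _ => hentry i j i
  have hform (j k : Fin m) : ContDiffOn ℝ r (fun x => contractionForm (Γ x) j k) s := by
    simp only [contractionForm, of_apply]
    exact ContDiffOn.sum fun l _ => (hω l).mul (hentry j k l)
  have hv (j : Fin m) : ContDiffOn ℝ r (fun x => distinguishedVector (Γ x) j) s := by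
    simp only [distinguishedVector, vecMul, dotProduct]
    exact ContDiffOn.sum fun l _ => (hω l).mul (contDiffOn_matrix_inv hform hβ l j)
  have hiter (l : ℕ) (k : Fin m) :
      ContDiffOn ℝ r (fun x => iterates (Γ x) (distinguishedVector (Γ x)) l k) s := by
    induction l generalizing k with
    | zero => simpa only [iterates_zero] using hv k
    | succ l ih =>
      simp only [iterates_succ, leftMul_mulVec_apply]
      exact ContDiffOn.sum fun a _ => ContDiffOn.sum fun b _ =>
        ((hv a).mul (ih b)).mul (hentry a b k)
  exact hiter i k

end Smooth

/-! ### Nonvanishing on torsion free symbols -/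

theorem exists_eval_lineMap_mul_ne_zero {σ K : Type*} [CommRing K] [IsDomain K] [Infinite K]
    {P Q : MvPolynomial σ K} {x y : σ → K} (hP : MvPolynomial.eval x P ≠ 0)
    (hQ : MvPolynomial.eval y Q ≠ 0) :
    ∃ t : K, MvPolynomial.eval (AffineMap.lineMap x y t) (P * Q) ≠ 0 := by
  let onLine : MvPolynomial σ K →ₐ[K] Polynomial K := MvPolynomial.aeval fun i =>
    Polynomial.X * Polynomial.C (y i - x i) + Polynomial.C (x i)
  have heval (t : K) (R : MvPolynomial σ K) :
      (onLine R).eval t = MvPolynomial.eval (AffineMap.lineMap x y t) R := by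
    rw [← Polynomial.coe_aeval_eq_eval, MvPolynomial.comp_aeval_apply,
      ← MvPolynomial.aeval_eq_eval]
    congr 2
    funext i
    simp [AffineMap.lineMap_apply]
  have hP' : onLine P ≠ 0 := fun h => hP (by simpa [h] using (heval 0 P).symm)
  have hQ' : onLine Q ≠ 0 := fun h => hQ (by simpa [h] using (heval 1 Q).symm)
  by_contra! h
  refine mul_ne_zero hP' hQ' (Polynomial.funext fun t => ?_)
  rw [← map_mul, heval, h, Polynomial.eval_zero]

section Umbilic

variable {n : ℕ}

/-- The torsion free symbols `Γ(x, y) = ⟨x, y⟩ e₀ + x₀ y + y₀ x`, whose Ricci tensor is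
nondegenerate. -/
def umbilicSymbols (n : ℕ) : W (n + 1) := fun i j k =>
  (if i = j then if k = 0 then 1 else 0 else 0) + (if i = 0 then if j = k then 1 else 0 else 0) +
    if j = 0 then if i = k then 1 else 0 else 0

theorem umbilicSymbols_mem_Z (n : ℕ) : umbilicSymbols n ∈ Z (n + 1) := by
  intro i j k
  simp only [umbilicSymbols, eq_comm (a := i) (b := j)]
  ring

theorem contraction_umbilicSymbols (n : ℕ) :
    contraction (umbilicSymbols n) = (n + 3 : ℝ) • Pi.single 0 1 := by
  funext j
  rcases eq_or_ne j 0 with rfl | hj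
  · simp only [contraction, umbilicSymbols, ↓reduceIte, Finset.sum_add_distrib,
      Finset.sum_ite_eq', Finset.mem_univ, Finset.sum_const, Finset.card_univ, Fintype.card_fin,
      nsmul_eq_mul, Nat.cast_add, Nat.cast_one, mul_one, Pi.smul_apply, Pi.single_eq_same,
      smul_eq_mul]
    ring
  · simp [contraction, umbilicSymbols, Finset.sum_add_distrib, hj]

theorem leftMul_umbilicSymbols (x : Fin (n + 1) → ℝ) :
    leftMul (umbilicSymbols n) x =
      vecMulVec (Pi.single 0 1) x + x 0 • (1 : Matrix _ _ ℝ) + vecMulVec x (Pi.single 0 1) := by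
  ext k b
  simp [leftMul, umbilicSymbols, mul_add, Finset.sum_add_distrib, vecMulVec_apply,
    Pi.single_apply, one_apply, eq_comm (a := b) (b := k)]

theorem ricci_umbilicSymbols (n : ℕ) :
    ricci (umbilicSymbols n) =
      (n + 1 : ℝ) • (1 : Matrix _ _ ℝ) +
        (n - 1 : ℝ) • vecMulVec (Pi.single 0 1) (Pi.single 0 1) := by
  refine matrix_eq_of_dotProduct fun x y => ?_
  have hright : rightMul (umbilicSymbols n) y = leftMul (umbilicSymbols n) y :=
    congrArg (leftMul · y) (funext fun i => funext fun j => funext fun k =>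
      umbilicSymbols_mem_Z n j i k)
  rw [dotProduct_ricci, hright, contraction_umbilicSymbols, leftMul_umbilicSymbols,
    leftMul_umbilicSymbols]
  simp only [add_mulVec, vecMulVec_mulVec, op_smul_eq_smul, smul_mulVec, one_mulVec,
    single_dotProduct, one_mul, dotProduct_add, dotProduct_smul, dotProduct_single, Pi.smul_apply,
    Pi.single_eq_same, smul_eq_mul, mul_one, smul_dotProduct, Matrix.mul_add, Matrix.add_mul,
    vecMulVec_mul_vecMulVec, vecMulVec_smul, Algebra.smul_mul_assoc, one_smul,
    Algebra.mul_smul_comm, smul_add, trace_add, trace_smul, trace_vecMulVec, trace_one,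
    Fintype.card_fin, Nat.cast_add, Nat.cast_one]
  ring

theorem symRicci_umbilicSymbols (n : ℕ) :
    symRicci (umbilicSymbols n) =
      diagonal fun i => (n + 1 : ℝ) + if i = 0 then (n - 1 : ℝ) else 0 := by
  have hdiag : (n + 1 : ℝ) • (1 : Matrix (Fin (n + 1)) (Fin (n + 1)) ℝ) +
      (n - 1 : ℝ) • vecMulVec (Pi.single 0 1) (Pi.single 0 1) =
        diagonal fun i => (n + 1 : ℝ) + if i = 0 then (n - 1 : ℝ) else 0 := by
    ext i j
    rcases eq_or_ne i j with rfl | hij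
    · rcases eq_or_ne i 0 with rfl | hi
      · simp [vecMulVec_apply]
      · simp [vecMulVec_apply, hi]
    · have hij0 : j = 0 → i = 0 → (n : ℝ) - 1 = 0 := fun hj hi => absurd (hi.trans hj.symm) hij
      simpa [vecMulVec_apply, Pi.single_apply, hij] using hij0
  rw [symRicci, ricci_umbilicSymbols, hdiag, diagonal_transpose, ← two_smul ℝ, smul_smul]
  norm_num

theorem det_symRicci_umbilicSymbols_ne_zero (hn : 1 ≤ n) :
    (symRicci (umbilicSymbols n)).det ≠ 0 := by
  rw [symRicci_umbilicSymbols, det_diagonal]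
  refine Finset.prod_ne_zero_iff.2 fun i _ => ?_
  have hn' : (1 : ℝ) ≤ n := by exact_mod_cast hn
  split_ifs <;> linarith

end Umbilic

section Shift

variable {n : ℕ}

/-- The torsion free normalized symbols with `Γ(e₀, eⱼ) = eⱼ₊₁`, where the last index is its own
successor, and `Γ(eᵢ, eⱼ) = e₀ + δᵢⱼ eᵢ` for `i, j ≠ 0`; their form `ω (Γ(·, ·))` is
nondegenerate. -/
def shiftSymbols (n : ℕ) : W (n + 1) := fun i j k =>
  if i = 0 then if k = Order.succ j then 1 else 0
  else if j = 0 then if k = Order.succ i then 1 else 0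
  else (if k = 0 then 1 else 0) + if i = j then if k = i then 1 else 0 else 0

theorem shiftSymbols_zero_right (i k : Fin (n + 1)) :
    shiftSymbols n i 0 k = if k = Order.succ i then 1 else 0 := by
  rcases eq_or_ne i 0 with rfl | hi
  · simp [shiftSymbols]
  · simp [shiftSymbols, hi]

theorem shiftSymbols_mem_Z (n : ℕ) : shiftSymbols n ∈ Z (n + 1) := by
  intro i j k
  rcases eq_or_ne i 0 with rfl | hi
  · rw [shiftSymbols_zero_right]
    simp [shiftSymbols]
  rcases eq_or_ne j 0 with rfl | hj
  · rw [shiftSymbols_zero_right]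
    simp [shiftSymbols]
  rcases eq_or_ne i j with rfl | hij
  · rfl
  · simp [shiftSymbols, hi, hj, hij, hij.symm]

theorem contraction_shiftSymbols (j : Fin (n + 1)) : contraction (shiftSymbols n) j = 1 := by
  rcases eq_or_ne j 0 with rfl | hj
  · simp only [contraction, shiftSymbols_zero_right]
    rw [Fin.sum_univ_castSucc]
    simp [Fin.orderSucc_castSucc, Fin.orderSucc_last, Fin.ext_iff]
  · rw [contraction, Finset.sum_eq_single j]
    · simp [shiftSymbols, hj]
    · intro i _ hij
      have hsucc : (0 : Fin (n + 1)) ≠ Order.succ j :=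
        ((Fin.pos_iff_ne_zero.2 hj).trans_le (Order.le_succ j)).ne
      rcases eq_or_ne i 0 with rfl | hi
      · simp [shiftSymbols, hsucc]
      · simp [shiftSymbols, hi, hj, hij]
    · simp

theorem isNormalized_shiftSymbols (n : ℕ) : IsNormalized (shiftSymbols n) := by
  refine ⟨fun i => funext fun k => ?_, ?_, fun i => ?_⟩
  · simp [shiftSymbols, Fin.orderSucc_castSucc, Pi.single_apply]
  · simp [shiftSymbols]
  · rw [contraction_shiftSymbols, contraction_shiftSymbols]

theorem contractionForm_shiftSymbols (i j : Fin (n + 1)) :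
    contractionForm (shiftSymbols n) i j = 1 + if i = j then if i = 0 then 0 else 1 else 0 := by
  simp only [contractionForm, of_apply, contraction_shiftSymbols, one_mul]
  rcases eq_or_ne i 0 with rfl | hi
  · simp [shiftSymbols]
  rcases eq_or_ne j 0 with rfl | hj
  · simp [shiftSymbols, hi]
  · rcases eq_or_ne i j with rfl | hij
    · simp [shiftSymbols, hi, Finset.sum_add_distrib]
    · simp [shiftSymbols, hi, hj, hij]

theorem det_contractionForm_shiftSymbols_ne_zero (n : ℕ) :
    (contractionForm (shiftSymbols n)).det ≠ 0 := by
  intro h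
  obtain ⟨x, hx, hker⟩ := exists_mulVec_eq_zero_iff.2 h
  have hrow (i : Fin (n + 1)) : ∑ j, x j + (if i = 0 then 0 else x i) = 0 := by
    simpa only [mulVec, dotProduct, contractionForm_shiftSymbols, add_mul, one_mul, ite_mul,
      zero_mul, Finset.sum_add_distrib, Finset.sum_ite_eq, Finset.mem_univ, if_true,
      Pi.zero_apply] using congrFun hker i
  have hsum : ∑ j, x j = 0 := by simpa using hrow 0
  have hsucc (i : Fin (n + 1)) (hi : i ≠ 0) : x i = 0 := by simpa [hsum, hi] using hrow i
  refine hx (funext fun i => ?_)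
  rcases eq_or_ne i 0 with rfl | hi
  · rwa [Finset.sum_eq_single 0 (fun j _ hj => hsucc j hj) (by simp)] at hsum
  · exact hsucc i hi

theorem frameDiscriminant_shiftSymbols_ne_zero (n : ℕ) :
    frameDiscriminant (shiftSymbols n) ≠ 0 := by
  have hβ := det_contractionForm_shiftSymbols_ne_zero n
  refine mul_ne_zero hβ ((det_iterateMatrix_adjugate_ne_zero_iff hβ).2 ?_)
  rw [(isNormalized_shiftSymbols n).frame_eq_one hβ, det_one]
  exact one_ne_zero

end Shift

theorem exists_mem_Z_evalAt_genericityPoly_ne_zero {n : ℕ} (hn : 1 ≤ n) :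
    ∃ Γ ∈ Z (n + 1), (genericityPoly (n + 1)).evalAt Γ ≠ 0 := by
  have hdet : (detSymRicciPoly (n + 1)).evalAt (umbilicSymbols n) ≠ 0 := by
    rw [evalAt_detSymRicciPoly]
    exact det_symRicci_umbilicSymbols_ne_zero hn
  have hframe : (frameDiscriminantPoly (n + 1)).evalAt (shiftSymbols n) ≠ 0 := by
    rw [evalAt_frameDiscriminantPoly]
    exact frameDiscriminant_shiftSymbols_ne_zero n
  obtain ⟨t, ht⟩ := exists_eval_lineMap_mul_ne_zero hdet hframe
  exact ⟨AffineMap.lineMap (umbilicSymbols n) (shiftSymbols n) t,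
    AffineMap.lineMap_mem (Q := (Z (n + 1)).toAffineSubspace) t (umbilicSymbols_mem_Z n)
      (shiftSymbols_mem_Z n), ht⟩

/-! ### Generic symbols form principal domains -/

theorem changeCoord_mem_Z {m : ℕ} (M N : Matrix (Fin m) (Fin m) ℝ) {Γ : W m} (hΓ : Γ ∈ Z m) :
    changeCoord M N Γ ∈ Z m := by
  have hswap : (fun i j => Γ j i) = Γ := funext fun i => funext fun j => funext fun k => hΓ j i k
  have h := changeCoord_swap Γ M N
  rw [hswap] at h
  exact fun i j k => (congrFun (congrFun (congrFun h i) j) k).symm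

theorem smul_eq_changeCoord {m : ℕ} (T : GL(m, ℝ)⁺) (Γ : W m) :
    T • Γ = changeCoord (mat T) (mat T⁻¹) Γ := rfl

theorem contDiff_changeCoord {E : Type*} [NormedAddCommGroup E] [NormedSpace ℝ E] {m : ℕ}
    {r : ℕ∞ω} {M N : E → Matrix (Fin m) (Fin m) ℝ} {Γ : E → W m}
    (hM : ∀ i j, ContDiff ℝ r fun x => M x i j) (hN : ∀ i j, ContDiff ℝ r fun x => N x i j)
    (hΓ : ContDiff ℝ r Γ) : ContDiff ℝ r fun x => changeCoord (M x) (N x) (Γ x) := by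
  unfold changeCoord
  fun_prop

theorem exists_mul_self_eq_one_det_neg (n : ℕ) :
    ∃ D : Matrix (Fin (n + 1)) (Fin (n + 1)) ℝ, D * D = 1 ∧ D.det < 0 := by
  refine ⟨diagonal fun i => if i = 0 then -1 else 1, ?_, ?_⟩
  · rw [diagonal_mul_diagonal, ← diagonal_one]
    congr 1
    funext i
    split_ifs <;> norm_num
  · simp

theorem contMDiff_comp_val {X Y : Type*} [NormedAddCommGroup X] [NormedSpace ℝ X]
    [NormedAddCommGroup Y] [NormedSpace ℝ Y] (j : X →L[ℝ] Y) (U : TopologicalSpace.Opens X) :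
    ContMDiff 𝓘(ℝ, X) 𝓘(ℝ, Y) ∞ fun x : U => j x :=
  j.contDiff.contMDiff.comp contMDiff_subtype_val

/-- An open set `U` of generic symbols in a representation `j : X → 𝒲(m)` of `GL⁺(m, ℝ)` which is
invariant under the changes of coordinates of either orientation. The two cases of interest are
`X = 𝒲(m)` and `X = 𝒵(m)`. -/
structure IsGenericDomain {m : ℕ} {X : Type*} [NormedAddCommGroup X] [NormedSpace ℝ X]
    [MulAction (GL(m, ℝ)⁺) X] (j : X →L[ℝ] W m) (U : TopologicalSpace.Opens X) : Prop where
  injective : Function.Injective j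
  map_smul : ∀ (T : GL(m, ℝ)⁺) x, j (T • x) = T • j x
  isGeneric : ∀ x ∈ U, IsGeneric (j x)
  exists_changeCoord : ∀ x ∈ U, ∀ M N : Matrix (Fin m) (Fin m) ℝ, N * M = 1 →
    ∃ y ∈ U, j y = changeCoord M N (j x)

namespace IsGenericDomain

variable {m : ℕ} {X : Type*} [NormedAddCommGroup X] [NormedSpace ℝ X] [MulAction (GL(m, ℝ)⁺) X]
  {j : X →L[ℝ] W m} {U : TopologicalSpace.Opens X}

theorem smul_mem (h : IsGenericDomain j U) (T : GL(m, ℝ)⁺) (x : X) (hx : x ∈ U) : T • x ∈ U := by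
  obtain ⟨y, hy, hyx⟩ := h.exists_changeCoord x hx (mat T) (mat T⁻¹) (mat_inv_mul_mat T)
  rw [← smul_eq_changeCoord, ← h.map_smul, h.injective.eq_iff] at hyx
  exact hyx ▸ hy

theorem contMDiff_of_comp (h : IsGenericDomain j U) {EM HM M : Type*} [NormedAddCommGroup EM]
    [NormedSpace ℝ EM] [TopologicalSpace HM] {IM : ModelWithCorners ℝ EM HM} [TopologicalSpace M]
    [ChartedSpace HM M] {f : M → U} (hf : ContMDiff IM 𝓘(ℝ, W m) ∞ fun x => j (f x)) :
    ContMDiff IM 𝓘(ℝ, X) ∞ f := by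
  obtain ⟨k, hk⟩ :=
    j.toLinearMap.exists_leftInverse_of_injective (LinearMap.ker_eq_bot.2 h.injective)
  refine (ContMDiff.subtypeVal_comp_iff U f).1 <|
    ((LinearMap.toContinuousLinearMap k).contDiff.contMDiff.comp hf).congr fun x => ?_
  exact (LinearMap.congr_fun hk (f x : X)).symm

section Action

variable [MulAction (GL(m, ℝ)⁺) U]

theorem contMDiff_smul (h : IsGenericDomain j U)
    (hcoe : ∀ (T : GL(m, ℝ)⁺) (x : U), ((T • x : U) : X) = T • (x : X)) :
    ContMDiff (𝓘(ℝ, Fin m → Fin m → ℝ).prod 𝓘(ℝ, X)) 𝓘(ℝ, X) ∞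
      fun z : GL(m, ℝ)⁺ × U => z.1 • z.2 := by
  have changeCoord_smooth :
      ContDiff ℝ ∞ fun z : (Fin m → Fin m → ℝ) × (Fin m → Fin m → ℝ) × W m =>
        changeCoord (of z.1) (of z.2.1) z.2.2 :=
    contDiff_changeCoord (fun i j => by simp only [of_apply]; fun_prop)
      (fun i j => by simp only [of_apply]; fun_prop) (by fun_prop)
  refine h.contMDiff_of_comp ((changeCoord_smooth.contMDiff.comp
    (((contMDiff_mat m).comp contMDiff_fst).prodMk_space
      (((contMDiff_mat m).comp ((contMDiff_inv_glpos m).comp contMDiff_fst)).prodMk_space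
        ((contMDiff_comp_val j U).comp contMDiff_snd)))).congr fun z => ?_)
  exact (congrArg j (hcoe z.1 z.2)).trans (h.map_smul z.1 z.2)

theorem isMovingFrame (h : IsGenericDomain j U)
    (hcoe : ∀ (T : GL(m, ℝ)⁺) (x : U), ((T • x : U) : X) = T • (x : X)) :
    IsMovingFrame 𝓘(ℝ, X) fun x : U => frame (j x) where
  contMDiff := by
    have hframe : ContDiffOn ℝ ∞ (fun x k i => frame (j x) k i) U :=
      contDiffOn_pi.2 fun k => contDiffOn_pi.2 fun i => contDiffOn_frame j.contDiff.contDiffOn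
        (fun x hx => (h.isGeneric x hx).det_contractionForm_ne_zero) k i
    exact hframe.contMDiffOn.comp_contMDiff contMDiff_subtype_val fun x => x.2
  det_ne_zero x := (h.isGeneric x x.2).det_frame_ne_zero
  map_smul T x := by
    rw [hcoe, h.map_smul, smul_eq_changeCoord, frame_changeCoord (mat_inv_mul_mat T)]

end Action

theorem exists_involution (h : IsGenericDomain j U) {D : Matrix (Fin m) (Fin m) ℝ}
    (hD : D * D = 1) :
    ∃ σ : U → U, ContMDiff 𝓘(ℝ, X) 𝓘(ℝ, X) ∞ σ ∧ Function.Involutive σ ∧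
      ∀ x, frame (j (σ x)) = D * frame (j x) := by
  choose σ hσU hσ using fun x : U => h.exists_changeCoord x x.2 D D hD
  refine ⟨fun x => ⟨σ x, hσU x⟩, h.contMDiff_of_comp ?_, fun x => ?_, fun x => ?_⟩
  · have hD_smooth : ContDiff ℝ ∞ (changeCoord D D : W m → W m) :=
      contDiff_changeCoord (fun _ _ => contDiff_const) (fun _ _ => contDiff_const) contDiff_id
    exact (hD_smooth.contMDiff.comp (contMDiff_comp_val j U)).congr hσ
  · refine Subtype.ext (h.injective ?_)
    simp only [hσ, changeCoord_changeCoord, hD, changeCoord_one]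
  · simp only [hσ, frame_changeCoord hD]

end IsGenericDomain

namespace IsGenericDomain

variable {n : ℕ} {X : Type*} [NormedAddCommGroup X] [NormedSpace ℝ X]
  [MulAction (GL(n + 1, ℝ)⁺) X] {j : X →L[ℝ] W (n + 1)} {U : TopologicalSpace.Opens X}

theorem exists_frame_eq_one_chart (h : IsGenericDomain j U) {x₀ : X} (hx₀ : IsNormalized (j x₀)) :
    ∃ (d : ℕ) (Ω : TopologicalSpace.Opens (EuclideanSpace ℝ (Fin d))) (s : Ω → U)
      (r : U → EuclideanSpace ℝ (Fin d)), ContMDiff (𝓡 d) 𝓘(ℝ, X) ∞ s ∧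
        ContMDiff 𝓘(ℝ, X) (𝓡 d) ∞ r ∧ (∀ u, r (s u) = u) ∧
        Set.range s = {x : U | frame (j x) = 1} := by
  have : FiniteDimensional ℝ X := FiniteDimensional.of_injective j.toLinearMap h.injective
  obtain ⟨d, r, ι, hr, hι, hrι, hιS, hιr⟩ :=
    exists_affine_chart ((normalizedSymbols n).comap j.toLinearMap.toAffineMap) hx₀
  refine ⟨d, ⟨ι ⁻¹' U, U.isOpen.preimage hι.continuous⟩, fun u => ⟨ι u, u.2⟩, fun x => r x,
    ?_, hr.contMDiff.comp contMDiff_subtype_val, fun u => hrι u, Set.ext fun x => ?_⟩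
  · exact (ContMDiff.subtypeVal_comp_iff U _).1 (hι.contMDiff.comp contMDiff_subtype_val)
  · rw [Set.mem_ofPred_eq, frame_eq_one_iff (h.isGeneric x x.2).det_contractionForm_ne_zero]
    constructor
    · rintro ⟨u, rfl⟩
      exact hιS u
    · intro hx
      have hιrx : ι (r x) = x := hιr hx
      have hmem : ι (r x) ∈ U := by rw [hιrx]; exact x.2
      exact ⟨⟨r x, hmem⟩, Subtype.ext hιrx⟩

theorem isPrincipalDomain (h : IsGenericDomain j U) {x₀ : X} (hx₀ : IsNormalized (j x₀)) :
    IsPrincipalDomain (n + 1) (U : Set X) := by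
  let _ : MulAction (GL(n + 1, ℝ)⁺) U := restrictAction U h.smul_mem
  have hcoe (T : GL(n + 1, ℝ)⁺) (x : U) : ((T • x : U) : X) = T • (x : X) := rfl
  obtain ⟨D, hDD, hD⟩ := exists_mul_self_eq_one_det_neg n
  obtain ⟨σ, hσ_smooth, hσσ, hσ⟩ := h.exists_involution hDD
  obtain ⟨d, Ω, s, r, hs_smooth, hr, hrs, hs⟩ := h.exists_frame_eq_one_chart hx₀
  obtain ⟨q, φ, slice⟩ := (h.isMovingFrame hcoe).exists_isGlobalSlice hD (h.contMDiff_smul hcoe)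
    hσ_smooth hσ hσσ hs_smooth hr hrs hs
  exact ⟨U.isOpen, h.smul_mem, slice.properSMul, slice.stabilizer_eq_bot,
    slice.hasSmoothPrincipalQuotient⟩

end IsGenericDomain

section PrincipalDomains

variable {n p q : ℕ}

theorem changeCoord_mem_wGen {m : ℕ} {Γ : W m} (hΓ : Γ ∈ WGen p q (genericityPoly m))
    {M N : Matrix (Fin m) (Fin m) ℝ} (hNM : N * M = 1) :
    changeCoord M N Γ ∈ WGen p q (genericityPoly m) :=
  ⟨hΓ.1.changeCoord hNM, (evalAt_genericityPoly_ne_zero_iff _).2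
    (((evalAt_genericityPoly_ne_zero_iff _).1 hΓ.2).changeCoord hNM)⟩

theorem isPrincipalDomain_wGen (hpq : p + q = n + 1) :
    IsPrincipalDomain (n + 1) (WGen p q (genericityPoly (n + 1))) := by
  have h : IsGenericDomain (ContinuousLinearMap.id ℝ (W (n + 1)))
      ⟨WGen p q (genericityPoly (n + 1)), isOpen_wGen hpq _⟩ :=
    { injective := Function.injective_id
      map_smul := fun _ _ => rfl
      isGeneric := fun Γ hΓ => (evalAt_genericityPoly_ne_zero_iff Γ).1 hΓ.2
      exists_changeCoord := fun Γ hΓ M N hNM =>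
        ⟨changeCoord M N Γ, changeCoord_mem_wGen hΓ hNM, rfl⟩ }
  exact h.isPrincipalDomain (x₀ := shiftSymbols n) (isNormalized_shiftSymbols n)

theorem isPrincipalDomain_zGen (hpq : p + q = n + 1) :
    IsPrincipalDomain (n + 1) (ZGen p q (genericityPoly (n + 1))) := by
  have h : IsGenericDomain (Z (n + 1)).subtypeL
      ⟨ZGen p q (genericityPoly (n + 1)), (isOpen_wGen hpq _).preimage continuous_subtype_val⟩ :=
    { injective := Subtype.val_injective
      map_smul := fun _ _ => rfl
      isGeneric := fun Γ hΓ => (evalAt_genericityPoly_ne_zero_iff (Γ : W (n + 1))).1 hΓ.2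
      exists_changeCoord := fun Γ hΓ M N hNM =>
        ⟨⟨changeCoord M N Γ, changeCoord_mem_Z M N Γ.2⟩, changeCoord_mem_wGen hΓ hNM, rfl⟩ }
  exact h.isPrincipalDomain (x₀ := ⟨shiftSymbols n, shiftSymbols_mem_Z n⟩)
    (isNormalized_shiftSymbols n)

end PrincipalDomains

end TypeA

end

theorem theorem1p6_general (m : ℕ) (hm : 2 ≤ m) :
    ∃ P : TypeA.WPoly m,
      TypeA.detSymRicciPoly m ∣ P ∧
      (∃ Γ ∈ TypeA.Z m, P.evalAt Γ ≠ 0) ∧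
      ∀ p q : ℕ, p + q = m →
        TypeA.IsPrincipalDomain m (TypeA.WGen p q P) ∧
        TypeA.IsPrincipalDomain m (TypeA.ZGen p q P) := by
  obtain ⟨n, rfl⟩ : ∃ n, m = n + 1 := ⟨m - 1, by omega⟩
  exact ⟨TypeA.genericityPoly (n + 1), dvd_mul_right _ _,
    TypeA.exists_mem_Z_evalAt_genericityPoly_ne_zero (by omega), fun p q hpq =>
      ⟨TypeA.isPrincipalDomain_wGen hpq, TypeA.isPrincipalDomain_zGen hpq⟩⟩

theorem theorem1p6 (m : ℕ) (hm : 3 ≤ m) :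
    ∃ P : TypeA.WPoly m,
      TypeA.detSymRicciPoly m ∣ P ∧
      (∃ Γ ∈ TypeA.Z m, P.evalAt Γ ≠ 0) ∧
      ∀ p q : ℕ, p + q = m →
        TypeA.IsPrincipalDomain m (TypeA.WGen p q P) ∧
        TypeA.IsPrincipalDomain m (TypeA.ZGen p q P) :=
  theorem1p6_general m (by omega)
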